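/- Let $(M,g)$ be a complete noncompact smooth Riemannian manifold (second countable, without boundary) of dimension $n>1$, with volume measure $dx$. Let $C>0$, and let $\rho:M\to[0,\infty)$ be a locally Lipschitz function such that $|\nabla\rho|=1$ almost everywhere on $M\setminus\rho^{-1}(0)$ and $\Delta\rho\ge \frac{C}{\rho}$ on $M\setminus\rho^{-1}(0)$ in the sense of distributions, i.e. $$-\int_M\langle\nabla\rho,\nabla\psi\rangle\,dx\;\ge\;\int_M\frac{C}{\rho}\,\psi\,dx\qquad\text{for all }\psi\in C_c^\infty(M\setminus\rho^{-1}(0))\text{ with }\psi\ge 0 .$$ Then for all real numbers $p$ and $\alpha$ with $1\le p<\infty$ and $C+1+\alpha-p>0$, and for every real-valued $\phi\in C_c^\infty(M\setminus\rho^{-1}(0))$, $$\int_M\rho^{\alpha}|\nabla\phi|^p\,dx\;\ge\;\Big(\frac{C+1+\alpha-p}{p}\Big)^p\int_M\rho^{\alpha}\,\frac{|\phi|^p}{\rho^{p}}\,dx .$$ -/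

import Mathlib

open Bundle Manifold MeasureTheory
open scoped ContDiff ENNReal

/-- The `i`-th coordinate vector field `∂/∂xᵢ` of the chart `e`, at the point of `M` with
coordinates `y`. -/
noncomputable def coordVector (n : ℕ) {M : Type*} [TopologicalSpace M]
    [ChartedSpace (EuclideanSpace ℝ (Fin n)) M]
    (e : OpenPartialHomeomorph M (EuclideanSpace ℝ (Fin n))) (y : EuclideanSpace ℝ (Fin n))
    (i : Fin n) : TangentSpace (𝓡 n) (e.symm y) :=
  (mfderiv (𝓡 n) (𝓡 n) e.symm y : EuclideanSpace ℝ (Fin n) →L[ℝ] TangentSpace (𝓡 n) (e.symm y))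
    (EuclideanSpace.single i (1 : ℝ))

/-- The density `√(det (gᵢⱼ))`, with `gᵢⱼ = ⟨∂/∂xᵢ, ∂/∂xⱼ⟩`, in the coordinates of `e`. -/
noncomputable def volumeDensity (n : ℕ) {M : Type*} [TopologicalSpace M]
    [ChartedSpace (EuclideanSpace ℝ (Fin n)) M]
    [RiemannianBundle (fun x : M ↦ TangentSpace (𝓡 n) x)]
    (e : OpenPartialHomeomorph M (EuclideanSpace ℝ (Fin n))) (y : EuclideanSpace ℝ (Fin n)) : ℝ :=
  Real.sqrt (Matrix.det (Matrix.of fun i j : Fin n ↦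
    inner ℝ (coordVector n e y i) (coordVector n e y j)))

/-- The Riemannian volume of the domain of the chart `e`, as a measure on `M`: the image under
`e.symm` of the measure `√(det (gᵢⱼ)) dx` on the target of `e`. -/
noncomputable def chartVolume (n : ℕ) {M : Type*} [TopologicalSpace M]
    [ChartedSpace (EuclideanSpace ℝ (Fin n)) M]
    [RiemannianBundle (fun x : M ↦ TangentSpace (𝓡 n) x)] [MeasurableSpace M]
    (e : OpenPartialHomeomorph M (EuclideanSpace ℝ (Fin n))) : Measure M :=
  Measure.map e.symm
    (((volume : Measure (EuclideanSpace ℝ (Fin n))).restrict e.target).withDensity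
      fun y ↦ ENNReal.ofReal (volumeDensity n e y))

/-- The Riemannian volume measure. The measures `chartVolume n e` agree on overlaps of charts (they
are the restrictions of the volume to the chart domains), and for a second countable `M` their
least upper bound in the complete lattice of measures is the volume measure, the unique measure
whose restriction to the domain of each chart `e` is `chartVolume n e`. -/
noncomputable def riemannianVolume (n : ℕ) (M : Type*) [TopologicalSpace M]
    [ChartedSpace (EuclideanSpace ℝ (Fin n)) M]
    [RiemannianBundle (fun x : M ↦ TangentSpace (𝓡 n) x)] [MeasurableSpace M] : Measure M :=
  ⨆ e ∈ atlas (EuclideanSpace ℝ (Fin n)) M, chartVolume n e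

/-- The Riemannian gradient: the vector `∇f(x)` with `⟨∇f(x), v⟩ = df(x) v` for all `v`. It is `0`
where `f` is not differentiable. -/
noncomputable def riemannianGrad (n : ℕ) {M : Type*} [TopologicalSpace M]
    [ChartedSpace (EuclideanSpace ℝ (Fin n)) M]
    [RiemannianBundle (fun x : M ↦ TangentSpace (𝓡 n) x)] (f : M → ℝ) (x : M) :
    TangentSpace (𝓡 n) x :=
  haveI : FiniteDimensional ℝ (TangentSpace (𝓡 n) x) :=
    inferInstanceAs (FiniteDimensional ℝ (EuclideanSpace ℝ (Fin n)))
  haveI : CompleteSpace (TangentSpace (𝓡 n) x) := FiniteDimensional.complete ℝ _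
  (InnerProductSpace.toDual ℝ (TangentSpace (𝓡 n) x)).symm
    (mfderiv (𝓡 n) 𝓘(ℝ, ℝ) f x : TangentSpace (𝓡 n) x →L[ℝ] ℝ)

theorem inner_riemannianGrad (n : ℕ) {M : Type*} [TopologicalSpace M]
    [ChartedSpace (EuclideanSpace ℝ (Fin n)) M]
    [RiemannianBundle (fun x : M ↦ TangentSpace (𝓡 n) x)] (f : M → ℝ) (x : M)
    (v : TangentSpace (𝓡 n) x) :
    inner ℝ (riemannianGrad n f x) v = (mfderiv (𝓡 n) 𝓘(ℝ, ℝ) f x v : ℝ) := by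
  have : FiniteDimensional ℝ (TangentSpace (𝓡 n) x) :=
    inferInstanceAs (FiniteDimensional ℝ (EuclideanSpace ℝ (Fin n)))
  have : CompleteSpace (TangentSpace (𝓡 n) x) := FiniteDimensional.complete ℝ _
  exact InnerProductSpace.toDual_symm_apply

/-- `φ ∈ C_c^∞(U)`: a smooth real function on `M` with compact support contained in `U`. -/
structure IsTestFunction (n : ℕ) {M : Type*} [TopologicalSpace M]
    [ChartedSpace (EuclideanSpace ℝ (Fin n)) M] (U : Set M) (φ : M → ℝ) : Prop where
  contMDiff : ContMDiff (𝓡 n) 𝓘(ℝ, ℝ) ∞ φ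
  hasCompactSupport : HasCompactSupport φ
  tsupport_subset : tsupport φ ⊆ U

/-- `Δρ ≥ f` on `U` in the sense of distributions, for a locally Lipschitz function `ρ`. The
gradient `∇ρ`, which exists almost everywhere, is a locally bounded vector field, and `Δρ` is its
distributional divergence `ψ ↦ -∫ ⟨∇ρ, ∇ψ⟩`. -/
def DistribLaplacianGE (n : ℕ) {M : Type*} [TopologicalSpace M]
    [ChartedSpace (EuclideanSpace ℝ (Fin n)) M]
    [RiemannianBundle (fun x : M ↦ TangentSpace (𝓡 n) x)] [MeasurableSpace M]
    (U : Set M) (ρ f : M → ℝ) : Prop :=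
  ∀ ψ : M → ℝ, IsTestFunction n U ψ → (∀ x, 0 ≤ ψ x) →
    ∫ x, f x * ψ x ∂(riemannianVolume n M) ≤
      -∫ x, inner ℝ (riemannianGrad n ρ x) (riemannianGrad n ψ x) ∂(riemannianVolume n M)

/-! Put γ = α + 1 - p and test Δρ ≥ C/ρ against ψ = ρ^γ |φ|^p. Where |∇ρ| = 1, the part of -⟨∇ρ, ∇ψ⟩
that differentiates ρ^γ is -γ ρ^(γ-1) |φ|^p, and the part that differentiates |φ|^p is at most p ρ^γ
|φ|^(p-1) |∇φ|. Write A = ∫ ρ^α |φ|^p / ρ^p and B = ∫ ρ^α |∇φ|^p. Since γ - 1 = α - p, the result is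
(C + γ) A ≤ p ∫ ρ^γ |φ|^(p-1) |∇φ|. By Young's inequality with a parameter l > 0, the right side
times l^(p-1) is at most (p-1) l^p A + B. The choice l = (C + γ)/p makes the left side times l^(p-1)
equal to p l^p A, and as A is finite, subtraction leaves l^p A ≤ B. The pointwise half of this is
`neg_inner_riemannianGrad_rpow_mul_abs_rpow_le`.

The technical difficulty is that ψ is only locally Lipschitz, while the hypothesis speaks of smooth
test functions. `DistribLaplacianGE.of_lipschitzInChartAt` removes this gap. A smooth partition of
unity reduces to a test function supported in one chart, where `LipschitzWith.exists_smooth_approx`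
mollifies it: the mollifications converge uniformly, and their derivatives are uniformly bounded and
converge almost everywhere, so both sides pass to the limit by dominated convergence.

Two bridges connect this Euclidean argument to M. `riemannianVolume_ae_of_chart` turns Lebesgue-null
sets in a chart into null sets of the volume, through the change of variables formula on chart
overlaps. `LocallyLipschitz.lipschitzInChartAt` turns the Lipschitz condition for the Riemannian
distance into one in coordinates. -/

/-! ### Transformation of the volume density under a change of chart. -/

/-- The Gram determinant, for the metric at `x`, of the images under `A` of the standard basis. -/
noncomputable def gramDet (n : ℕ) {M : Type*} [TopologicalSpace M]
    [ChartedSpace (EuclideanSpace ℝ (Fin n)) M]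
    [RiemannianBundle (fun x : M ↦ TangentSpace (𝓡 n) x)] (x : M)
    (A : EuclideanSpace ℝ (Fin n) →L[ℝ] EuclideanSpace ℝ (Fin n)) : ℝ :=
  Matrix.det (Matrix.of fun i j : Fin n ↦
    @inner ℝ (TangentSpace (𝓡 n) x) _ (A (EuclideanSpace.single i (1 : ℝ)))
      (A (EuclideanSpace.single j (1 : ℝ))))

theorem inner_sum_smul_sum_smul {F : Type*} [NormedAddCommGroup F] [InnerProductSpace ℝ F]
    {ι : Type*} [Fintype ι] (a b : ι → ℝ) (v : ι → F) :
    inner ℝ (∑ k, a k • v k) (∑ l, b l • v l) = ∑ l, (∑ k, a k * inner ℝ (v k) (v l)) * b l := by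
  simp only [inner_sum, sum_inner, inner_smul_left, inner_smul_right, Finset.sum_mul]
  refine Finset.sum_congr rfl fun l _ ↦ ?_
  rw [Finset.mul_sum]
  refine Finset.sum_congr rfl fun k _ ↦ ?_
  simp [mul_comm, mul_left_comm]

theorem EuclideanSpace.sum_apply_smul_single {n : ℕ} (v : EuclideanSpace ℝ (Fin n)) :
    ∑ k, v k • EuclideanSpace.single k (1 : ℝ) = v := by
  have := (EuclideanSpace.basisFun (Fin n) ℝ).sum_repr v
  simpa using this

/-- The images of the basis vectors are the rows here, the transpose of the usual matrix, so that
this matrix multiplies the Gram matrix from the left in `gramDet_comp`. -/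
theorem ContinuousLinearMap.det_eq_det_of_single {n : ℕ}
    (T : EuclideanSpace ℝ (Fin n) →L[ℝ] EuclideanSpace ℝ (Fin n)) :
    T.det = Matrix.det (Matrix.of fun i k : Fin n ↦ T (EuclideanSpace.single i (1 : ℝ)) k) := by
  rw [ContinuousLinearMap.det, ← LinearMap.det_toMatrix (EuclideanSpace.basisFun (Fin n) ℝ).toBasis,
    ← Matrix.det_transpose]
  congr 1

/-- Precomposition with T changes the Gram matrix G into the congruent matrix T G Tᵀ. The base point
is fixed and the maps live on the model space, so derivatives can be substituted without changing
the tangent space. -/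
theorem gramDet_comp (n : ℕ) {M : Type*} [TopologicalSpace M]
    [ChartedSpace (EuclideanSpace ℝ (Fin n)) M]
    [RiemannianBundle (fun x : M ↦ TangentSpace (𝓡 n) x)] (x : M)
    (A T : EuclideanSpace ℝ (Fin n) →L[ℝ] EuclideanSpace ℝ (Fin n)) :
    gramDet n x (A.comp T) = T.det ^ 2 * gramDet n x A := by
  have key : (Matrix.of fun i j : Fin n ↦
      @inner ℝ (TangentSpace (𝓡 n) x) _ (A.comp T (EuclideanSpace.single i (1 : ℝ)))
        (A.comp T (EuclideanSpace.single j (1 : ℝ)))) =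
      (Matrix.of fun i k : Fin n ↦ T (EuclideanSpace.single i (1 : ℝ)) k) *
      (Matrix.of fun i j : Fin n ↦
        @inner ℝ (TangentSpace (𝓡 n) x) _ (A (EuclideanSpace.single i (1 : ℝ)))
          (A (EuclideanSpace.single j (1 : ℝ)))) *
      (Matrix.of fun i k : Fin n ↦ T (EuclideanSpace.single i (1 : ℝ)) k).transpose := by
    ext i j
    let v (k : Fin n) : TangentSpace (𝓡 n) x := A (EuclideanSpace.single k (1 : ℝ))
    have h (i : Fin n) : (A.comp T (EuclideanSpace.single i (1 : ℝ)) : TangentSpace (𝓡 n) x) =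
        ∑ k, (T (EuclideanSpace.single i (1 : ℝ)) k) • v k := by
      have h1 : A (T (EuclideanSpace.single i (1 : ℝ))) =
          ∑ k, (T (EuclideanSpace.single i (1 : ℝ)) k) • A (EuclideanSpace.single k (1 : ℝ)) := by
        conv_lhs => rw [← EuclideanSpace.sum_apply_smul_single (T (EuclideanSpace.single i (1 : ℝ)))]
        simp
      exact h1
    rw [Matrix.of_apply, h i, h j, inner_sum_smul_sum_smul]
    simp [Matrix.mul_apply, v]
  rw [gramDet, key, Matrix.det_mul, Matrix.det_mul, Matrix.det_transpose,
    ← ContinuousLinearMap.det_eq_det_of_single, gramDet]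
  ring

theorem volumeDensity_eq_sqrt_gramDet (n : ℕ) {M : Type*} [TopologicalSpace M]
    [ChartedSpace (EuclideanSpace ℝ (Fin n)) M]
    [RiemannianBundle (fun x : M ↦ TangentSpace (𝓡 n) x)]
    (e : OpenPartialHomeomorph M (EuclideanSpace ℝ (Fin n))) (y : EuclideanSpace ℝ (Fin n)) :
    volumeDensity n e y = √(gramDet n (e.symm y) (mfderiv (𝓡 n) (𝓡 n) e.symm y)) := rfl

section

variable {n : ℕ} {M : Type*} [TopologicalSpace M] [ChartedSpace (EuclideanSpace ℝ (Fin n)) M]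
  {e e' : OpenPartialHomeomorph M (EuclideanSpace ℝ (Fin n))}

/-- Near `y` the map `e.symm` equals `e'.symm ∘ (e' ∘ e.symm)`, and the chain rule applies. -/
theorem hasFDerivAt_chart_transition [IsManifold (𝓡 n) 1 M]
    (he : e ∈ atlas (EuclideanSpace ℝ (Fin n)) M) (he' : e' ∈ atlas (EuclideanSpace ℝ (Fin n)) M)
    {y : EuclideanSpace ℝ (Fin n)} (hy : y ∈ e.target) (hy' : e.symm y ∈ e'.source) :
    HasFDerivAt (e' ∘ e.symm) (fderiv ℝ (e' ∘ e.symm) y) y ∧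
    mfderiv (𝓡 n) (𝓡 n) e.symm y =
      (mfderiv (𝓡 n) (𝓡 n) e'.symm ((e' ∘ e.symm) y)).comp (fderiv ℝ (e' ∘ e.symm) y) := by
  have h1 : MDifferentiableAt (𝓡 n) (𝓡 n) e.symm y := mdifferentiableAt_atlas_symm he hy
  have h2 : MDifferentiableAt (𝓡 n) (𝓡 n) e' (e.symm y) := mdifferentiableAt_atlas he' hy'
  have h3 : MDifferentiableAt (𝓡 n) (𝓡 n) (e' ∘ e.symm) y := h2.comp y h1
  have h4 : DifferentiableAt ℝ (e' ∘ e.symm) y := mdifferentiableAt_iff_differentiableAt.1 h3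
  refine ⟨h4.hasFDerivAt, ?_⟩
  have h5 : MDifferentiableAt (𝓡 n) (𝓡 n) e'.symm ((e' ∘ e.symm) y) :=
    mdifferentiableAt_atlas_symm he' (e'.map_source hy')
  have h6 : e.symm =ᶠ[nhds y] e'.symm ∘ (e' ∘ e.symm) := by
    have : ∀ᶠ z in nhds y, e.symm z ∈ e'.source :=
      (e.continuousAt_symm hy).eventually (e'.open_source.mem_nhds hy')
    filter_upwards [this] with z hz
    simp [e'.left_inv hz]
  rw [h6.mfderiv_eq, mfderiv_comp y h5 h3, mfderiv_eq_fderiv]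
  rfl

theorem volumeDensity_chart_transition [IsManifold (𝓡 n) 1 M]
    [RiemannianBundle (fun x : M ↦ TangentSpace (𝓡 n) x)]
    (he : e ∈ atlas (EuclideanSpace ℝ (Fin n)) M) (he' : e' ∈ atlas (EuclideanSpace ℝ (Fin n)) M)
    {y : EuclideanSpace ℝ (Fin n)} (hy : y ∈ e.target) (hy' : e.symm y ∈ e'.source) :
    volumeDensity n e y =
      |(fderiv ℝ (e' ∘ e.symm) y).det| * volumeDensity n e' ((e' ∘ e.symm) y) := by
  have h := (hasFDerivAt_chart_transition he he' hy hy').2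
  rw [volumeDensity_eq_sqrt_gramDet, volumeDensity_eq_sqrt_gramDet]
  have h2 : e'.symm ((e' ∘ e.symm) y) = e.symm y := e'.left_inv hy'
  rw [h2]
  refine (congrArg Real.sqrt ((congrArg (gramDet n (e.symm y)) h).trans
    (gramDet_comp n (e.symm y) _ _))).trans ?_
  rw [Real.sqrt_mul (sq_nonneg _), Real.sqrt_sq_eq_abs]
  rfl

end

/-! ### Volume measure and null sets in a chart. -/

section

variable {n : ℕ} {M : Type*} [TopologicalSpace M]
  {e e' : OpenPartialHomeomorph M (EuclideanSpace ℝ (Fin n))}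
  [MeasurableSpace M] [BorelSpace M]

theorem measurableSet_target_inter_preimage_symm {s : Set M} (hs : MeasurableSet s) :
    MeasurableSet (e.target ∩ e.symm ⁻¹' s) := by
  have h : Measurable (fun y : e.target ↦ e.symm y) :=
    (continuousOn_iff_continuous_domRestrict.1 e.continuousOn_symm).measurable
  have := e.open_target.measurableSet.subtype_image (h hs)
  convert this using 1
  ext y; simp [and_comm]

theorem measurableSet_source_inter_preimage {s : Set (EuclideanSpace ℝ (Fin n))}
    (hs : MeasurableSet s) : MeasurableSet (e.source ∩ e ⁻¹' s) := by
  have h : Measurable (fun y : e.source ↦ e y) :=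
    (continuousOn_iff_continuous_domRestrict.1 e.continuousOn).measurable
  have := e.open_source.measurableSet.subtype_image (h hs)
  convert this using 1
  ext y; simp [and_comm]

variable [ChartedSpace (EuclideanSpace ℝ (Fin n)) M]
  [RiemannianBundle (fun x : M ↦ TangentSpace (𝓡 n) x)]

theorem chartVolume_apply {s : Set M} (hs : MeasurableSet s) :
    chartVolume n e s =
      ∫⁻ y in e.target ∩ e.symm ⁻¹' s, ENNReal.ofReal (volumeDensity n e y) := by
  -- `e.symm` is controlled only on the target, so it is measurable only almost everywhere for the
  -- restricted measure.
  have hae : AEMeasurable e.symm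
      ((volume : Measure (EuclideanSpace ℝ (Fin n))).restrict e.target) :=
    e.continuousOn_symm.aemeasurable e.open_target.measurableSet
  have hac := withDensity_absolutelyContinuous
      ((volume : Measure (EuclideanSpace ℝ (Fin n))).restrict e.target)
      (fun y ↦ ENNReal.ofReal (volumeDensity n e y))
  rw [chartVolume, Measure.map_apply_of_aemeasurable (hae.mono_ac hac) hs]
  have hm := measurableSet_target_inter_preimage_symm (e := e) hs
  have h0 : (((volume : Measure (EuclideanSpace ℝ (Fin n))).restrict e.target).withDensity
      fun y ↦ ENNReal.ofReal (volumeDensity n e y)) (e.target)ᶜ = 0 := by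
    apply hac
    rw [Measure.restrict_apply e.open_target.measurableSet.compl]; simp
  rw [← measure_inter_add_sdiff (e.symm ⁻¹' s) e.open_target.measurableSet,
    measure_mono_null (Set.sdiff_subset_compl _ _) h0, add_zero, Set.inter_comm,
    withDensity_apply _ hm, Measure.restrict_restrict hm,
    Set.inter_eq_left.2 Set.inter_subset_left]

/-- On the overlap this is the change of variables formula for the injective map `e' ∘ e.symm`,
whose Jacobian is the ratio of the two densities. The inequality suffices, because only upper bounds
on the volume are used. -/
theorem chartVolume_restrict_source_le [IsManifold (𝓡 n) 1 M]
    (he : e ∈ atlas (EuclideanSpace ℝ (Fin n)) M) (he' : e' ∈ atlas (EuclideanSpace ℝ (Fin n)) M) :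
    (chartVolume n e').restrict e.source ≤ chartVolume n e := by
  refine Measure.le_iff.2 fun s hs ↦ ?_
  rw [Measure.restrict_apply hs, chartVolume_apply (hs.inter e.open_source.measurableSet),
    chartVolume_apply hs]
  set A := e.target ∩ e.symm ⁻¹' (s ∩ e'.source) with hA
  have hAm : MeasurableSet A :=
    measurableSet_target_inter_preimage_symm (hs.inter e'.open_source.measurableSet)
  have himage : e'.target ∩ e'.symm ⁻¹' (s ∩ e.source) = (e' ∘ e.symm) '' A := by
    ext z
    constructor
    · rintro ⟨hz, hzs, hze⟩
      refine ⟨e (e'.symm z), ⟨e.map_source hze, ?_⟩, ?_⟩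
      · simp only [Set.mem_preimage, e.left_inv hze]
        exact ⟨hzs, e'.map_target hz⟩
      · simp [e.left_inv hze, e'.right_inv hz]
    · rintro ⟨y, ⟨hy, hys, hye⟩, rfl⟩
      refine ⟨e'.map_source hye, ?_⟩
      simp only [Set.mem_preimage, Function.comp_apply, e'.left_inv hye]
      exact ⟨hys, e.map_target hy⟩
  have hinj : Set.InjOn (e' ∘ e.symm) A := by
    rintro y ⟨hy, -, hye⟩ z ⟨hz, -, hze⟩ h
    exact e.symm.injOn hy hz (e'.injOn hye hze h)
  rw [himage, lintegral_image_eq_lintegral_abs_det_fderiv_mul volume hAm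
    (fun y hy ↦ (hasFDerivAt_chart_transition he he' hy.1 hy.2.2).1.hasFDerivWithinAt) hinj]
  calc ∫⁻ y in A, ENNReal.ofReal |(fderiv ℝ (e' ∘ e.symm) y).det| *
          ENNReal.ofReal (volumeDensity n e' ((e' ∘ e.symm) y))
      = ∫⁻ y in A, ENNReal.ofReal (volumeDensity n e y) := by
        refine setLIntegral_congr_fun hAm fun y hy ↦ ?_
        rw [volumeDensity_chart_transition he he' hy.1 hy.2.2, ENNReal.ofReal_mul (abs_nonneg _)]
    _ ≤ _ := lintegral_mono_set (Set.inter_subset_inter_right _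
        (Set.preimage_mono Set.inter_subset_left))

theorem riemannianVolume_restrict_source_le [IsManifold (𝓡 n) 1 M]
    (he : e ∈ atlas (EuclideanSpace ℝ (Fin n)) M) :
    (riemannianVolume n M).restrict e.source ≤ chartVolume n e := by
  classical
  have hs := e.open_source.measurableSet
  -- To bound the supremum, one measure must dominate every chart volume on all of M. Putting `⊤`
  -- off the source achieves this, and the term disappears on restriction.
  have h : riemannianVolume n M ≤ chartVolume n e + (⊤ : Measure M).restrict e.sourceᶜ := by
    refine iSup₂_le fun e' he' ↦ ?_
    rw [← Measure.restrict_add_restrict_compl (μ := chartVolume n e') hs]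
    exact add_le_add (chartVolume_restrict_source_le he he')
      (Measure.restrict_mono le_rfl le_top)
  calc _ ≤ (chartVolume n e + (⊤ : Measure M).restrict e.sourceᶜ).restrict e.source :=
        Measure.restrict_mono le_rfl h
    _ = (chartVolume n e).restrict e.source := by
        rw [Measure.restrict_add, Measure.restrict_restrict hs]; simp
    _ ≤ _ := Measure.restrict_le_self

/-- Sets that are Lebesgue-null in a chart are null for the Riemannian volume. -/
theorem riemannianVolume_ae_of_chart [IsManifold (𝓡 n) 1 M]
    (he : e ∈ atlas (EuclideanSpace ℝ (Fin n)) M) {P : EuclideanSpace ℝ (Fin n) → Prop}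
    (hP : ∀ᵐ y, P y) : ∀ᵐ x ∂(riemannianVolume n M), x ∈ e.source → P (e x) := by
  rw [← ae_restrict_iff' e.open_source.measurableSet]
  refine (Measure.absolutelyContinuous_of_le (riemannianVolume_restrict_source_le he)).ae_le ?_
  obtain ⟨N, hsub, hN, h0⟩ := exists_measurable_superset_of_null (ae_iff.1 hP)
  have hm := measurableSet_source_inter_preimage (e := e) hN
  have h1 : chartVolume n e (e.source ∩ e ⁻¹' N) = 0 := by
    rw [chartVolume_apply hm]
    refine setLIntegral_measure_zero _ _ (measure_mono_null ?_ h0)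
    rintro y ⟨hy, -, hyN⟩
    simpa [e.right_inv hy] using hyN
  have h2 : chartVolume n e e.sourceᶜ = 0 := by
    rw [chartVolume_apply e.open_source.measurableSet.compl]
    refine setLIntegral_measure_zero _ _ (measure_mono_null (t := ∅) ?_ (by simp))
    rintro y ⟨hy, hys⟩
    exact (hys (e.map_target hy)).elim
  refine ae_iff.2 (measure_mono_null ?_ (measure_union_null h1 h2))
  intro x hx
  by_cases hxe : x ∈ e.source
  · exact Or.inl ⟨hxe, hsub hx⟩
  · exact Or.inr hxe

end

/-! ### Gradients and coordinate frames in a chart. -/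

section

open Topology Filter

variable {n : ℕ} {M : Type*} [TopologicalSpace M] [ChartedSpace (EuclideanSpace ℝ (Fin n)) M]

theorem riemannianGrad_eq_iff [RiemannianBundle (fun x : M ↦ TangentSpace (𝓡 n) x)]
    (f : M → ℝ) (x : M) (w : TangentSpace (𝓡 n) x) :
    riemannianGrad n f x = w ↔ ∀ v, inner ℝ w v = (mfderiv (𝓡 n) 𝓘(ℝ, ℝ) f x v : ℝ) := by
  constructor
  · rintro rfl v; exact inner_riemannianGrad n f x v
  · intro h
    refine ext_inner_right ℝ fun v ↦ ?_
    rw [inner_riemannianGrad, h]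

theorem Filter.EventuallyEq.riemannianGrad_eq [RiemannianBundle (fun x : M ↦ TangentSpace (𝓡 n) x)]
    {f g : M → ℝ} {x : M} (h : f =ᶠ[𝓝 x] g) :
    riemannianGrad n f x = riemannianGrad n g x := by
  simp only [riemannianGrad, h.mfderiv_eq]

theorem riemannianGrad_eq_zero_of_not_mdifferentiableAt
    [RiemannianBundle (fun x : M ↦ TangentSpace (𝓡 n) x)]
    {f : M → ℝ} {x : M}
    (h : ¬ MDifferentiableAt (𝓡 n) 𝓘(ℝ, ℝ) f x) : riemannianGrad n f x = 0 := by
  rw [riemannianGrad_eq_iff, mfderiv_zero_of_not_mdifferentiableAt h]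
  intro v
  rw [inner_zero_left]
  rfl

theorem riemannianGrad_eq_zero_of_eventuallyEq
    [RiemannianBundle (fun x : M ↦ TangentSpace (𝓡 n) x)]
    {f : M → ℝ} {x : M} (h : f =ᶠ[𝓝 x] 0) :
    riemannianGrad n f x = 0 := by
  rw [h.riemannianGrad_eq, riemannianGrad_eq_iff]
  intro v
  have : mfderiv (𝓡 n) 𝓘(ℝ, ℝ) (0 : M → ℝ) x = 0 := mfderiv_const
  rw [this, inner_zero_left]
  rfl

theorem riemannianGrad_eq_zero_of_notMem_tsupport
    [RiemannianBundle (fun x : M ↦ TangentSpace (𝓡 n) x)]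
    {f : M → ℝ} {x : M} (h : x ∉ tsupport f) :
    riemannianGrad n f x = 0 :=
  riemannianGrad_eq_zero_of_eventuallyEq (notMem_tsupport_iff_eventuallyEq.1 h)

variable [IsManifold (𝓡 n) 1 M]

variable (n) in
/-- The frame of coordinate vector fields of the chart at `x₀`, evaluated at `x`. -/
noncomputable def chartFrame (x₀ x : M) : EuclideanSpace ℝ (Fin n) →L[ℝ] TangentSpace (𝓡 n) x :=
  (trivializationAt (EuclideanSpace ℝ (Fin n)) (TangentSpace (𝓡 n)) x₀).symmL ℝ x

variable (n) in
/-- The differential at `x` of the chart at `x₀`. -/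
noncomputable def chartCoframe (x₀ x : M) : TangentSpace (𝓡 n) x →L[ℝ] EuclideanSpace ℝ (Fin n) :=
  (trivializationAt (EuclideanSpace ℝ (Fin n)) (TangentSpace (𝓡 n)) x₀).continuousLinearMapAt ℝ x

theorem chartFrame_chartCoframe {x₀ x : M}
    (hx : x ∈ (chartAt (EuclideanSpace ℝ (Fin n)) x₀).source) (v : TangentSpace (𝓡 n) x) :
    chartFrame n x₀ x (chartCoframe n x₀ x v) = v :=
  Trivialization.symmL_continuousLinearMapAt _ (by simpa using hx) v

theorem chartCoframe_chartFrame {x₀ x : M}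
    (hx : x ∈ (chartAt (EuclideanSpace ℝ (Fin n)) x₀).source) (v : EuclideanSpace ℝ (Fin n)) :
    chartCoframe n x₀ x (chartFrame n x₀ x v) = v :=
  Trivialization.continuousLinearMapAt_symmL _ (by simpa using hx) v

theorem mfderiv_chartAt {x₀ x : M}
    (hx : x ∈ (chartAt (EuclideanSpace ℝ (Fin n)) x₀).source) :
    mfderiv (𝓡 n) (𝓡 n) (chartAt (EuclideanSpace ℝ (Fin n)) x₀) x = chartCoframe n x₀ x := by
  rw [chartCoframe, TangentBundle.continuousLinearMapAt_trivializationAt hx]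
  rfl

theorem mfderiv_chartAt_symm {x₀ : M} {y : EuclideanSpace ℝ (Fin n)}
    (hy : y ∈ (chartAt (EuclideanSpace ℝ (Fin n)) x₀).target) :
    mfderiv (𝓡 n) (𝓡 n) (chartAt (EuclideanSpace ℝ (Fin n)) x₀).symm y =
      chartFrame n x₀ ((chartAt (EuclideanSpace ℝ (Fin n)) x₀).symm y) := by
  set e := chartAt (EuclideanSpace ℝ (Fin n)) x₀
  have hx : e.symm y ∈ e.source := e.map_target hy
  have h1 := (mdifferentiable_chart (I := 𝓡 n) x₀).comp_symm_deriv hy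
  have h2 : mfderiv (𝓡 n) (𝓡 n) e (e.symm y) = chartCoframe n x₀ (e.symm y) := mfderiv_chartAt hx
  rw [h2] at h1
  ext1 v
  have h3 : chartCoframe n x₀ (e.symm y) (mfderiv (𝓡 n) (𝓡 n) e.symm y v) = v :=
    congrArg (fun L ↦ L v) h1
  rw [← chartFrame_chartCoframe hx (mfderiv (𝓡 n) (𝓡 n) e.symm y v), h3]
  rfl

theorem mdifferentiableAt_iff_chart {x₀ x : M}
    (hx : x ∈ (chartAt (EuclideanSpace ℝ (Fin n)) x₀).source) {f : M → ℝ} :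
    MDifferentiableAt (𝓡 n) 𝓘(ℝ, ℝ) f x ↔
      DifferentiableAt ℝ (f ∘ (chartAt (EuclideanSpace ℝ (Fin n)) x₀).symm)
        (chartAt (EuclideanSpace ℝ (Fin n)) x₀ x) := by
  set e := chartAt (EuclideanSpace ℝ (Fin n)) x₀
  have he := mdifferentiable_chart (I := 𝓡 n) x₀
  rw [← mdifferentiableAt_iff_differentiableAt]
  constructor
  · intro h
    have h' : MDifferentiableAt (𝓡 n) 𝓘(ℝ, ℝ) f (e.symm (e x)) := by rwa [e.left_inv hx]
    exact h'.comp (e x) (he.mdifferentiableAt_symm (e.map_source hx))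
  · intro h
    refine (h.comp x (he.mdifferentiableAt hx)).congr_of_eventuallyEq ?_
    filter_upwards [e.open_source.mem_nhds hx] with z hz
    simp [e.left_inv hz]

/-- At a point of non-differentiability both sides are zero by convention, so the formula needs no
regularity of `f`. This is what makes gradients of arbitrary functions measurable later. -/
theorem mfderiv_eq_chart {x₀ x : M}
    (hx : x ∈ (chartAt (EuclideanSpace ℝ (Fin n)) x₀).source) (f : M → ℝ) (v : TangentSpace (𝓡 n) x) :
    (mfderiv (𝓡 n) 𝓘(ℝ, ℝ) f x v : ℝ) =
      fderiv ℝ (f ∘ (chartAt (EuclideanSpace ℝ (Fin n)) x₀).symm)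
        (chartAt (EuclideanSpace ℝ (Fin n)) x₀ x) (chartCoframe n x₀ x v) := by
  set e := chartAt (EuclideanSpace ℝ (Fin n)) x₀
  have he := mdifferentiable_chart (I := 𝓡 n) x₀
  by_cases h : MDifferentiableAt (𝓡 n) 𝓘(ℝ, ℝ) f x
  · have h1 := (mdifferentiableAt_iff_chart hx).1 h
    have h2 : f =ᶠ[𝓝 x] (f ∘ e.symm) ∘ e := by
      filter_upwards [e.open_source.mem_nhds hx] with z hz
      simp [e.left_inv hz]
    have h3 := h1.mdifferentiableAt
    rw [h2.mfderiv_eq, mfderiv_comp x h3 (he.mdifferentiableAt hx), mfderiv_eq_fderiv]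
    rw [← mfderiv_chartAt hx]
    rfl
  · rw [mfderiv_zero_of_not_mdifferentiableAt h,
      fderiv_zero_of_not_differentiableAt fun h' ↦ h ((mdifferentiableAt_iff_chart hx).2 h')]
    rfl

variable [RiemannianBundle (fun x : M ↦ TangentSpace (𝓡 n) x)]

theorem inner_riemannianGrad_chart {x₀ x : M}
    (hx : x ∈ (chartAt (EuclideanSpace ℝ (Fin n)) x₀).source) (f : M → ℝ) (v : TangentSpace (𝓡 n) x) :
    inner ℝ (riemannianGrad n f x) v =
      fderiv ℝ (f ∘ (chartAt (EuclideanSpace ℝ (Fin n)) x₀).symm)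
        (chartAt (EuclideanSpace ℝ (Fin n)) x₀ x) (chartCoframe n x₀ x v) :=
  (inner_riemannianGrad n f x v).trans (mfderiv_eq_chart hx f v)

theorem riemannianGrad_sum {ι : Type*} {s : Finset ι} {f : ι → M → ℝ} {x : M}
    (hf : ∀ i ∈ s, MDifferentiableAt (𝓡 n) 𝓘(ℝ, ℝ) (f i) x) :
    riemannianGrad n (fun z ↦ ∑ i ∈ s, f i z) x = ∑ i ∈ s, riemannianGrad n (f i) x := by
  have hx := mem_chart_source (EuclideanSpace ℝ (Fin n)) x
  refine ext_inner_right ℝ fun v ↦ ?_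
  have h := HasFDerivAt.fun_sum fun i hi ↦
    ((mdifferentiableAt_iff_chart hx).1 (hf i hi)).hasFDerivAt
  rw [inner_riemannianGrad_chart hx, sum_inner]
  simp only [inner_riemannianGrad_chart hx]
  rw [← sum_apply, ← h.fderiv]
  rfl

/-- The chain rule for a function of two real functions. -/
theorem riemannianGrad_comp₂ {f g : M → ℝ} {x : M} {F : ℝ × ℝ → ℝ} {a b : ℝ}
    (hf : MDifferentiableAt (𝓡 n) 𝓘(ℝ, ℝ) f x) (hg : MDifferentiableAt (𝓡 n) 𝓘(ℝ, ℝ) g x)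
    (hF : HasFDerivAt F (a • ContinuousLinearMap.fst ℝ ℝ ℝ + b • ContinuousLinearMap.snd ℝ ℝ ℝ)
      (f x, g x)) :
    riemannianGrad n (fun z ↦ F (f z, g z)) x =
      a • riemannianGrad n f x + b • riemannianGrad n g x := by
  set e := chartAt (EuclideanSpace ℝ (Fin n)) x
  have hx := mem_chart_source (EuclideanSpace ℝ (Fin n)) x
  have h1 := ((mdifferentiableAt_iff_chart hx).1 hf).hasFDerivAt
  have h2 := ((mdifferentiableAt_iff_chart hx).1 hg).hasFDerivAt
  have hex : e.symm (e x) = x := e.left_inv hx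
  have hF' : HasFDerivAt F
      (a • ContinuousLinearMap.fst ℝ ℝ ℝ + b • ContinuousLinearMap.snd ℝ ℝ ℝ)
      ((f ∘ e.symm) (e x), (g ∘ e.symm) (e x)) := by
    simpa [hex] using hF
  have h3 := hF'.comp (e x) (h1.prodMk h2)
  refine ext_inner_right ℝ fun v ↦ ?_
  have h4 : (fun z ↦ F (f z, g z)) ∘ e.symm = F ∘ fun y ↦ ((f ∘ e.symm) y, (g ∘ e.symm) y) := rfl
  rw [inner_add_left, inner_smul_left, inner_smul_left, inner_riemannianGrad_chart hx,
    inner_riemannianGrad_chart hx, inner_riemannianGrad_chart hx, h4, h3.fderiv]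
  simp

/-- Serves at the zeros of φ, where the test function ρ^γ |φ|^p has a minimum; differentiability
there need not be discussed. -/
theorem riemannianGrad_eq_zero_of_isLocalMin {f : M → ℝ} {x : M} (h : IsLocalMin f x) :
    riemannianGrad n f x = 0 := by
  set e := chartAt (EuclideanSpace ℝ (Fin n)) x
  have hx := mem_chart_source (EuclideanSpace ℝ (Fin n)) x
  have hex : e.symm (e x) = x := e.left_inv hx
  have h1 : IsLocalMin (f ∘ e.symm) (e x) := by
    have hc : Tendsto e.symm (𝓝 (e x)) (𝓝 x) := by
      simpa [ContinuousAt, hex] using e.continuousAt_symm (e.map_source hx)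
    have := hc.eventually h
    filter_upwards [this] with z hz
    simpa [hex] using hz
  refine ext_inner_right ℝ fun v ↦ ?_
  rw [inner_riemannianGrad_chart hx, h1.fderiv_eq_zero]
  simp

/-- Pair the gradient with itself, bound the coordinate expression by operator norms, and cancel one
factor of its norm. -/
theorem norm_riemannianGrad_le {x₀ x : M}
    (hx : x ∈ (chartAt (EuclideanSpace ℝ (Fin n)) x₀).source) (f : M → ℝ) :
    ‖riemannianGrad n f x‖ ≤ ‖fderiv ℝ (f ∘ (chartAt (EuclideanSpace ℝ (Fin n)) x₀).symm)
        (chartAt (EuclideanSpace ℝ (Fin n)) x₀ x)‖ * ‖chartCoframe n x₀ x‖ := by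
  set w := riemannianGrad n f x with hw
  have h1 : ‖w‖ ^ 2 = _ :=
    (real_inner_self_eq_norm_sq w).symm.trans (inner_riemannianGrad_chart hx f w)
  have h2 : ‖w‖ ^ 2 ≤ (‖fderiv ℝ (f ∘ (chartAt (EuclideanSpace ℝ (Fin n)) x₀).symm)
        (chartAt (EuclideanSpace ℝ (Fin n)) x₀ x)‖ * ‖chartCoframe n x₀ x‖) * ‖w‖ := by
    rw [h1, mul_assoc]
    have h3 := ContinuousLinearMap.le_opNorm
      (fderiv ℝ (f ∘ (chartAt (EuclideanSpace ℝ (Fin n)) x₀).symm)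
        (chartAt (EuclideanSpace ℝ (Fin n)) x₀ x)) (chartCoframe n x₀ x w)
    rw [Real.norm_eq_abs] at h3
    refine (le_abs_self _).trans (h3.trans ?_)
    gcongr
    exact ContinuousLinearMap.le_opNorm _ _
  rcases (norm_nonneg w).eq_or_lt with h0 | h0
  · rw [← h0]; positivity
  · nlinarith

variable [IsContinuousRiemannianBundle (EuclideanSpace ℝ (Fin n))
  (fun x : M ↦ TangentSpace (𝓡 n) x)]

theorem exists_eventually_norm_chartCoframe_le (x₀ : M) :
    ∃ C > 0, ∀ᶠ x in 𝓝 x₀, ‖chartCoframe n x₀ x‖ ≤ C := by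
  obtain ⟨C, hC, h⟩ := eventually_norm_trivializationAt_lt (EuclideanSpace ℝ (Fin n))
    (fun x : M ↦ TangentSpace (𝓡 n) x) x₀
  exact ⟨C, hC, h.mono fun x hx ↦ hx.le⟩

theorem exists_eventually_norm_chartFrame_le (x₀ : M) :
    ∃ C > 0, ∀ᶠ x in 𝓝 x₀, ‖chartFrame n x₀ x‖ ≤ C := by
  obtain ⟨C, hC, h⟩ := eventually_norm_symmL_trivializationAt_lt (EuclideanSpace ℝ (Fin n))
    (fun x : M ↦ TangentSpace (𝓡 n) x) x₀
  exact ⟨C, hC, h.mono fun x hx ↦ hx.le⟩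

theorem continuousOn_inner_chartFrame (x₀ : M) (v w : EuclideanSpace ℝ (Fin n)) :
    ContinuousOn (fun x ↦ (inner ℝ (chartFrame n x₀ x v) (chartFrame n x₀ x w) : ℝ))
      (chartAt (EuclideanSpace ℝ (Fin n)) x₀).source := by
  have h (v : EuclideanSpace ℝ (Fin n)) : ContinuousOn
      (fun x ↦ (chartFrame n x₀ x v : TotalSpace (EuclideanSpace ℝ (Fin n))
        (fun x : M ↦ TangentSpace (𝓡 n) x)))
      (chartAt (EuclideanSpace ℝ (Fin n)) x₀).source := by
    have := (trivializationAt (EuclideanSpace ℝ (Fin n)) (TangentSpace (𝓡 n))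
      x₀).continuousOn_symm.comp
      (f := fun x ↦ (x, v)) (s := (chartAt (EuclideanSpace ℝ (Fin n)) x₀).source)
      (by fun_prop) (by intro x hx; simpa using hx)
    refine this.congr fun x hx ↦ ?_
    simp only [chartFrame, Function.comp]
    rw [Trivialization.symmL_apply _ (by simpa using hx)]
  exact (h v).inner_bundle (h w)

end

/-! ### Mollification of Lipschitz functions on a vector space. -/

section

open Topology Filter Metric
open scoped Convolution NNReal

variable {E : Type*} [NormedAddCommGroup E] [NormedSpace ℝ E] [FiniteDimensional ℝ E]
  [MeasurableSpace E] [BorelSpace E] {μ : Measure E} [μ.IsAddHaarMeasure]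

/-- The mollification of a Lipschitz function is differentiable, and its derivative is the
mollification of the almost everywhere defined derivative. -/
theorem LipschitzWith.hasFDerivAt_normed_convolution {f : E → ℝ} {L : ℝ≥0}
    (hf : LipschitzWith L f) (η : ContDiffBump (0 : E)) (x : E) :
    HasFDerivAt (η.normed μ ⋆[ContinuousLinearMap.lsmul ℝ ℝ, μ] f)
      ((η.normed μ ⋆[ContinuousLinearMap.lsmul ℝ ℝ, μ] fderiv ℝ f) x) x := by
  have hη : Continuous (η.normed μ) := η.continuous_normed
  have hmeas (z : E) : Continuous fun t ↦ η.normed μ t * f (z - t) :=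
    hη.mul (hf.continuous.comp (continuous_const.sub continuous_id))
  -- Rademacher's theorem, carried along the measure-preserving map t ↦ x - t.
  have hmp : ∀ᵐ t ∂μ, DifferentiableAt ℝ f (x - t) :=
    (Measure.measurePreserving_sub_left μ x).quasiMeasurePreserving.ae hf.ae_differentiableAt
  -- The integral is differentiated with the derivative falling on `f` and not on the bump; the
  -- Lipschitz bound on `f` provides the domination.
  refine (hasFDerivAt_integral_of_dominated_loc_of_lip (𝕜 := ℝ) (s := Set.univ)
    (F := fun z t ↦ η.normed μ t * f (z - t)) (bound := fun t ↦ η.normed μ t * L)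
    univ_mem (Eventually.of_forall fun z ↦ (hmeas z).aestronglyMeasurable)
    ((hmeas x).integrable_of_hasCompactSupport η.hasCompactSupport_normed.mul_right) ?_ ?_ ?_ ?_).2
  · refine hη.aestronglyMeasurable.smul ?_
    exact ((measurable_fderiv ℝ f).comp (measurable_const.sub measurable_id)).aestronglyMeasurable
  · refine Eventually.of_forall fun t ↦ LipschitzOnWith.of_dist_le_mul fun a _ b _ ↦ ?_
    rw [Real.dist_eq, ← mul_sub, abs_mul, Real.coe_nnabs, abs_mul, NNReal.abs_eq, mul_assoc]
    gcongr
    simpa [Real.dist_eq] using hf.dist_le_mul (a - t) (b - t)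
  · exact η.integrable_normed.mul_const _
  · filter_upwards [hmp] with t ht
    have h1 : HasFDerivAt (fun z ↦ f (z - t)) (fderiv ℝ f (x - t)) x :=
      ht.hasFDerivAt.comp x ((hasFDerivAt_id x).sub_const t)
    exact h1.const_mul _

/-- Convolve with normalized bumps of radius 1/(k+1). The derivative of the convolution is an
average of `fderiv ℝ f`, hence bounded by `L`, and it converges almost everywhere by Lebesgue
differentiation. -/
theorem LipschitzWith.exists_smooth_approx {f : E → ℝ} {L : ℝ≥0}
    (hf : LipschitzWith L f) (h0 : ∀ x, 0 ≤ f x) :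
    ∃ g : ℕ → E → ℝ, (∀ k, ContDiff ℝ ∞ (g k)) ∧ (∀ k x, 0 ≤ g k x) ∧
      (∀ k x, ‖fderiv ℝ (g k) x‖ ≤ L) ∧ (∀ k x, |g k x - f x| ≤ L * (1 / ((k : ℝ) + 1))) ∧
      (∀ k, tsupport (g k) ⊆ cthickening (1 / ((k : ℝ) + 1)) (tsupport f)) ∧
      ∀ᵐ x ∂μ, Tendsto (fun k ↦ fderiv ℝ (g k) x) atTop (𝓝 (fderiv ℝ f x)) := by
  have hr (k : ℕ) : 0 < 1 / ((k : ℝ) + 1) := by positivity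
  let η (k : ℕ) : ContDiffBump (0 : E) :=
    ⟨1 / ((k : ℝ) + 1) / 2, 1 / ((k : ℝ) + 1), half_pos (hr k), half_lt_self (hr k)⟩
  let g (k : ℕ) : E → ℝ := (η k).normed μ ⋆[ContinuousLinearMap.lsmul ℝ ℝ, μ] f
  have hderiv (k : ℕ) (x : E) := hf.hasFDerivAt_normed_convolution (μ := μ) (η k) x
  have hint : LocallyIntegrable (fderiv ℝ f) μ := by
    refine (locallyIntegrable_const (L : ℝ)).mono
      (measurable_fderiv ℝ f).aestronglyMeasurable (Eventually.of_forall fun x ↦ ?_)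
    simpa using norm_fderiv_le_of_lipschitz ℝ hf
  have hdist (k : ℕ) (x : E) : |g k x - f x| ≤ L * (1 / ((k : ℝ) + 1)) := by
    refine (η k).dist_normed_convolution_le hf.continuous.aestronglyMeasurable fun y hy ↦ ?_
    refine (hf.dist_le_mul y x).trans ?_
    gcongr
    exact (mem_ball.1 hy).le
  have hrOut : Tendsto (fun k ↦ (η k).rOut) atTop (𝓝 0) := tendsto_one_div_add_atTop_nhds_zero_nat
  refine ⟨g, fun k ↦ ?_, fun k x ↦ ?_, fun k x ↦ ?_, hdist, fun k ↦ ?_, ?_⟩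
  · exact (η k).hasCompactSupport_normed.contDiff_convolution_left _ (η k).contDiff_normed
      hf.continuous.locallyIntegrable
  · exact integral_nonneg fun t ↦ mul_nonneg ((η k).nonneg_normed t) (h0 _)
  · rw [(hderiv k x).fderiv]
    calc ‖((η k).normed μ ⋆[ContinuousLinearMap.lsmul ℝ ℝ, μ] fderiv ℝ f) x‖
        ≤ ∫ t, (η k).normed μ t * L ∂μ := by
          refine norm_integral_le_of_norm_le ((η k).integrable_normed.mul_const _)
            (Eventually.of_forall fun t ↦ ?_)
          rw [ContinuousLinearMap.lsmul_apply, norm_smul, Real.norm_eq_abs,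
            abs_of_nonneg ((η k).nonneg_normed t)]
          exact mul_le_mul_of_nonneg_left (norm_fderiv_le_of_lipschitz ℝ hf)
            ((η k).nonneg_normed t)
      _ = L := by rw [integral_mul_const, (η k).integral_normed, one_mul]
  · refine closure_minimal (fun x hx ↦ ?_) isClosed_cthickening
    refine cthickening_subset_of_subset _ (subset_tsupport f) (thickening_subset_cthickening _ _ ?_)
    by_contra hx'
    have hball : ∀ y ∈ ball x (1 / ((k : ℝ) + 1)), f y = 0 := fun y hy ↦ by
      by_contra hy0
      exact hx' (mem_thickening_iff.2 ⟨y, hy0, mem_ball'.1 hy⟩)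
    have hfx := hball x (mem_ball_self (hr k))
    exact hx (((η k).normed_convolution_eq_right fun y hy ↦ (hball y hy).trans hfx.symm).trans hfx)
  -- `K = 2` is the ratio of outer to inner radius of each bump; its boundedness is needed for
  -- Lebesgue differentiation.
  · have := ContDiffBump.ae_convolution_tendsto_right_of_locallyIntegrable (μ := μ) (φ := η)
      (K := 2) hrOut (Eventually.of_forall fun k ↦ by simp only [η]; linarith) hint
    filter_upwards [this] with x hx
    simpa only [g, (hderiv _ x).fderiv] using hx

/-- Compactness gives a constant on the 1-neighbourhood of the support. A point of the support and a
point outside that neighbourhood are at distance at least 1, so there a bound on |f| serves as a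
Lipschitz constant. -/
theorem lipschitzWith_of_hasCompactSupport {X : Type*} [MetricSpace X] [ProperSpace X] {f : X → ℝ}
    (hf : LocallyLipschitz f) (hc : HasCompactSupport f) : ∃ L, LipschitzWith L f := by
  have hK : IsCompact (cthickening 1 (tsupport f)) := hc.isCompact.cthickening
  obtain ⟨L, hL⟩ := (hf.locallyLipschitzOn (s := cthickening 1 (tsupport f))
    ).exists_lipschitzOnWith_of_compact hK
  obtain ⟨B, hB⟩ := hc.exists_bound_of_continuous hf.continuous
  refine ⟨L + B.toNNReal, LipschitzWith.of_dist_le_mul fun x y ↦ ?_⟩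
  have key : ∀ x y, x ∈ tsupport f → dist (f x) (f y) ≤ ↑(L + B.toNNReal) * dist x y := by
    intro x y hx
    by_cases hy : y ∈ cthickening 1 (tsupport f)
    · refine (hL.dist_le_mul x (self_subset_cthickening _ hx) y hy).trans ?_
      gcongr
      exact le_self_add
    · have h1 : 1 ≤ dist x y := by
        by_contra! h
        exact hy (thickening_subset_cthickening _ _
          (mem_thickening_iff.2 ⟨x, hx, by rwa [dist_comm]⟩))
      have hy0 : f y = 0 := image_eq_zero_of_notMem_tsupport
        fun h ↦ hy (self_subset_cthickening _ h)
      rw [hy0, dist_zero_right]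
      refine (hB x).trans ((le_max_left B 0).trans ?_)
      rw [NNReal.coe_add, Real.coe_toNNReal']
      nlinarith [L.coe_nonneg, le_max_right B 0]
  by_cases hx : x ∈ tsupport f
  · exact key x y hx
  by_cases hy : y ∈ tsupport f
  · rw [dist_comm, dist_comm x]; exact key y x hy
  · rw [image_eq_zero_of_notMem_tsupport hx, image_eq_zero_of_notMem_tsupport hy, dist_self]
    positivity

end

/-! ### Metric coefficients, measurability of gradients, local finiteness of the volume. -/

section

open Topology Filter

variable {n : ℕ} {M : Type*} [TopologicalSpace M] [ChartedSpace (EuclideanSpace ℝ (Fin n)) M]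
  [IsManifold (𝓡 n) 1 M] [RiemannianBundle (fun x : M ↦ TangentSpace (𝓡 n) x)]

variable (n) in
/-- The matrix `gᵢⱼ` of the metric at `x` in the coordinates of the chart at `x₀`. -/
noncomputable def chartGram (x₀ x : M) : Matrix (Fin n) (Fin n) ℝ :=
  Matrix.of fun i j ↦ inner ℝ (chartFrame n x₀ x (EuclideanSpace.single i 1))
    (chartFrame n x₀ x (EuclideanSpace.single j 1))

theorem det_chartGram_ne_zero {x₀ x : M}
    (hx : x ∈ (chartAt (EuclideanSpace ℝ (Fin n)) x₀).source) : (chartGram n x₀ x).det ≠ 0 := by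
  have h : LinearIndependent ℝ
      fun i : Fin n ↦ chartFrame n x₀ x (EuclideanSpace.single i (1 : ℝ)) := by
    have h0 : LinearIndependent ℝ fun i : Fin n ↦ EuclideanSpace.single i (1 : ℝ) := by
      have h1 : (fun i : Fin n ↦ EuclideanSpace.single i (1 : ℝ)) =
          (EuclideanSpace.basisFun (Fin n) ℝ).toBasis := by ext; simp
      rw [h1]
      exact (EuclideanSpace.basisFun (Fin n) ℝ).toBasis.linearIndependent
    refine h0.map' (chartFrame n x₀ x).toLinearMap (LinearMap.ker_eq_bot.2 ?_)
    exact Function.LeftInverse.injective (chartCoframe_chartFrame hx)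
  exact Matrix.det_gram_ne_zero_iff_linearIndependent.2 h

/-- The inner product of gradients in local coordinates, `gⁱʲ ∂ᵢf ∂ⱼh`. -/
theorem inner_riemannianGrad_eq_sum {x₀ x : M}
    (hx : x ∈ (chartAt (EuclideanSpace ℝ (Fin n)) x₀).source) (f h : M → ℝ) :
    inner ℝ (riemannianGrad n f x) (riemannianGrad n h x) =
      ∑ j, (∑ i, fderiv ℝ (h ∘ (chartAt (EuclideanSpace ℝ (Fin n)) x₀).symm)
          (chartAt (EuclideanSpace ℝ (Fin n)) x₀ x) (EuclideanSpace.single i 1) *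
            (chartGram n x₀ x)⁻¹ i j) *
        fderiv ℝ (f ∘ (chartAt (EuclideanSpace ℝ (Fin n)) x₀).symm)
          (chartAt (EuclideanSpace ℝ (Fin n)) x₀ x) (EuclideanSpace.single j 1) := by
  set D := fderiv ℝ (f ∘ (chartAt (EuclideanSpace ℝ (Fin n)) x₀).symm)
    (chartAt (EuclideanSpace ℝ (Fin n)) x₀ x)
  set c := chartCoframe n x₀ x (riemannianGrad n h x) with hc
  have hv : riemannianGrad n h x =
      ∑ i, c i • chartFrame n x₀ x (EuclideanSpace.single i (1 : ℝ)) := by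
    rw [← chartFrame_chartCoframe hx (riemannianGrad n h x), ← hc]
    conv_lhs => rw [← EuclideanSpace.sum_apply_smul_single c]
    simp
  -- The components of dh are c G, with c the coordinates of ∇h and G the Gram matrix; inverting G
  -- recovers c.
  have hD : (fun j ↦ fderiv ℝ (h ∘ (chartAt (EuclideanSpace ℝ (Fin n)) x₀).symm)
      (chartAt (EuclideanSpace ℝ (Fin n)) x₀ x) (EuclideanSpace.single j 1)) =
      Matrix.vecMul (fun i ↦ c i) (chartGram n x₀ x) := by
    ext j
    rw [← chartCoframe_chartFrame hx (EuclideanSpace.single j 1),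
      ← inner_riemannianGrad_chart hx, hv, sum_inner]
    simp only [inner_smul_left]
    rfl
  have hcD : (fun i ↦ c i) = Matrix.vecMul (fun j ↦
      fderiv ℝ (h ∘ (chartAt (EuclideanSpace ℝ (Fin n)) x₀).symm)
        (chartAt (EuclideanSpace ℝ (Fin n)) x₀ x) (EuclideanSpace.single j 1))
      (chartGram n x₀ x)⁻¹ := by
    rw [hD, Matrix.vecMul_vecMul, Matrix.mul_nonsing_inv _ (det_chartGram_ne_zero hx).isUnit,
      Matrix.vecMul_one]
  rw [inner_riemannianGrad_chart hx, ← hc]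
  conv_lhs => rw [← EuclideanSpace.sum_apply_smul_single c]
  rw [map_sum]
  refine Finset.sum_congr rfl fun j _ ↦ ?_
  rw [map_smul, smul_eq_mul]
  congr 1
  exact congrFun hcD j

variable [IsContinuousRiemannianBundle (EuclideanSpace ℝ (Fin n))
  (fun x : M ↦ TangentSpace (𝓡 n) x)]

theorem continuousOn_chartGram (x₀ : M) :
    ContinuousOn (chartGram n x₀) (chartAt (EuclideanSpace ℝ (Fin n)) x₀).source :=
  continuousOn_pi.2 fun _ ↦ continuousOn_pi.2 fun _ ↦ continuousOn_inner_chartFrame x₀ _ _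

theorem continuousOn_volumeDensity (x₀ : M) :
    ContinuousOn (volumeDensity n (chartAt (EuclideanSpace ℝ (Fin n)) x₀))
      (chartAt (EuclideanSpace ℝ (Fin n)) x₀).target := by
  set e := chartAt (EuclideanSpace ℝ (Fin n)) x₀
  have h1 : ContinuousOn (fun y ↦ chartGram n x₀ (e.symm y)) e.target :=
    (continuousOn_chartGram x₀).comp e.continuousOn_symm e.mapsTo_symm
  have h2 : ContinuousOn (fun y ↦ √(chartGram n x₀ (e.symm y)).det) e.target := by
    rw [continuousOn_iff_continuous_domRestrict] at h1 ⊢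
    exact h1.matrix_det.sqrt
  refine h2.congr fun y hy ↦ ?_
  simp only [volumeDensity, coordVector]
  rw [mfderiv_chartAt_symm hy]
  rfl

variable [MeasurableSpace M] [BorelSpace M]

/-- The coordinate formula uses only the inverse Gram matrix, which is measurable, and `fderiv`,
which is a measurable function of the point for every function. -/
theorem aemeasurable_restrict_inner_riemannianGrad (x₀ : M) (f h : M → ℝ) (μ : Measure M) :
    AEMeasurable (fun x ↦ (inner ℝ (riemannianGrad n f x) (riemannianGrad n h x) : ℝ))
      (μ.restrict (chartAt (EuclideanSpace ℝ (Fin n)) x₀).source) := by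
  set e := chartAt (EuclideanSpace ℝ (Fin n)) x₀
  refine aemeasurable_restrict_of_measurable_subtype e.open_source.measurableSet ?_
  have hG : Continuous fun x : e.source ↦ chartGram n x₀ x :=
    continuousOn_iff_continuous_domRestrict.1 (continuousOn_chartGram x₀)
  have hGi (i j : Fin n) : Measurable fun x : e.source ↦ (chartGram n x₀ x)⁻¹ i j := by
    simp only [Matrix.inv_def, Matrix.smul_apply, smul_eq_mul, Ring.inverse_eq_inv']
    exact hG.matrix_det.measurable.inv.mul (hG.matrix_adjugate.matrix_elem i j).measurable
  have he : Measurable fun x : e.source ↦ e x :=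
    (continuousOn_iff_continuous_domRestrict.1 e.continuousOn).measurable
  have hfd (u : M → ℝ) (i : Fin n) : Measurable fun x : e.source ↦
      fderiv ℝ (u ∘ e.symm) (e x) (EuclideanSpace.single i 1) :=
    (measurable_fderiv_apply_const ℝ (u ∘ e.symm) (EuclideanSpace.single i 1)).comp he
  have : (fun x : e.source ↦ (inner ℝ (riemannianGrad n f x) (riemannianGrad n h x) : ℝ)) =
      fun x : e.source ↦ ∑ j, (∑ i, fderiv ℝ (h ∘ e.symm) (e x) (EuclideanSpace.single i 1) *
        (chartGram n x₀ x)⁻¹ i j) * fderiv ℝ (f ∘ e.symm) (e x) (EuclideanSpace.single j 1) :=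
    funext fun x ↦ inner_riemannianGrad_eq_sum x.2 f h
  rw [this]
  exact Finset.measurable_sum _ fun j _ ↦
    (Finset.measurable_sum _ fun i _ ↦ (hfd h i).mul (hGi i j)).mul (hfd f j)

theorem aemeasurable_inner_riemannianGrad [SecondCountableTopology M] (f h : M → ℝ)
    (μ : Measure M) :
    AEMeasurable (fun x ↦ (inner ℝ (riemannianGrad n f x) (riemannianGrad n h x) : ℝ)) μ := by
  obtain ⟨s, hs, hcov⟩ := TopologicalSpace.countable_cover_nhds
    fun x : M ↦ chart_source_mem_nhds (EuclideanSpace ℝ (Fin n)) x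
  have : Countable s := hs.to_subtype
  rw [← Measure.restrict_univ (μ := μ), ← hcov, Set.biUnion_eq_iUnion, aemeasurable_iUnion_iff]
  exact fun x ↦ aemeasurable_restrict_inner_riemannianGrad _ f h μ

theorem aemeasurable_norm_riemannianGrad [SecondCountableTopology M] (f : M → ℝ) (μ : Measure M) :
    AEMeasurable (fun x ↦ ‖riemannianGrad n f x‖) μ := by
  refine ((aemeasurable_inner_riemannianGrad (n := n) f f μ).sqrt).congr
    (Eventually.of_forall fun x ↦ ?_)
  exact (norm_eq_sqrt_real_inner _).symm

/-- The density is continuous in the chart, hence bounded on a small ball. Compact sets therefore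
have finite volume, on which every integrability claim rests. -/
instance : IsLocallyFiniteMeasure (riemannianVolume n M) := by
  refine ⟨fun x₀ ↦ ?_⟩
  set e := chartAt (EuclideanSpace ℝ (Fin n)) x₀
  have hx₀ : x₀ ∈ e.source := mem_chart_source _ x₀
  have hcont : ContinuousAt (volumeDensity n e) (e x₀) :=
    (continuousOn_volumeDensity x₀).continuousAt (e.open_target.mem_nhds (e.map_source hx₀))
  have hev : ∀ᶠ y in 𝓝 (e x₀), volumeDensity n e y ≤ volumeDensity n e (e x₀) + 1 :=
    hcont.eventually (Iic_mem_nhds (lt_add_one _))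
  obtain ⟨r, hr, hball⟩ := Metric.eventually_nhds_iff_ball.1 hev
  refine ⟨e.source ∩ e ⁻¹' Metric.ball (e x₀) r,
    (e.isOpen_inter_preimage Metric.isOpen_ball).mem_nhds ⟨hx₀, Metric.mem_ball_self hr⟩, ?_⟩
  have hm := measurableSet_source_inter_preimage (e := e) 
    (Metric.isOpen_ball (x := e x₀) (ε := r)).measurableSet
  calc riemannianVolume n M (e.source ∩ e ⁻¹' Metric.ball (e x₀) r)
      = (riemannianVolume n M).restrict e.source (e.source ∩ e ⁻¹' Metric.ball (e x₀) r) := by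
        rw [Measure.restrict_apply hm, Set.inter_eq_left.2 Set.inter_subset_left]
    _ ≤ chartVolume n e (e.source ∩ e ⁻¹' Metric.ball (e x₀) r) :=
        riemannianVolume_restrict_source_le (chart_mem_atlas _ x₀) _
    _ = ∫⁻ y in e.target ∩ e.symm ⁻¹' (e.source ∩ e ⁻¹' Metric.ball (e x₀) r),
          ENNReal.ofReal (volumeDensity n e y) := chartVolume_apply hm
    _ ≤ ∫⁻ y in Metric.ball (e x₀) r, ENNReal.ofReal (volumeDensity n e y) := by
        refine lintegral_mono_set ?_
        rintro y ⟨hy, -, hyb⟩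
        simpa [e.right_inv hy] using hyb
    _ ≤ ∫⁻ _ in Metric.ball (e x₀) r, ENNReal.ofReal (volumeDensity n e (e x₀) + 1) :=
        setLIntegral_mono measurable_const fun y hy ↦ ENNReal.ofReal_le_ofReal (hball y hy)
    _ < ⊤ := by
        rw [setLIntegral_const]
        exact ENNReal.mul_lt_top ENNReal.ofReal_lt_top measure_ball_lt_top

end

/-! ### Local Lipschitz continuity in charts. -/

section

open Topology Filter
open scoped NNReal

/-- `f` is Lipschitz near `x` in the coordinates of the preferred chart at `x`. -/
def LipschitzInChartAt (n : ℕ) {M : Type*} [TopologicalSpace M]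
    [ChartedSpace (EuclideanSpace ℝ (Fin n)) M] (f : M → ℝ) (x : M) : Prop :=
  ∃ K, ∃ t ∈ 𝓝 (chartAt (EuclideanSpace ℝ (Fin n)) x x),
    LipschitzOnWith K (f ∘ (chartAt (EuclideanSpace ℝ (Fin n)) x).symm) t

theorem exists_lipschitzOnWith_comp {X Y Z : Type*} [PseudoEMetricSpace X] [PseudoEMetricSpace Y]
    [PseudoEMetricSpace Z] {g : Y → Z} {f : X → Y} {x : X}
    (hg : ∃ K, ∃ t ∈ 𝓝 (f x), LipschitzOnWith K g t) (hf : ∃ K, ∃ t ∈ 𝓝 x, LipschitzOnWith K f t) :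
    ∃ K, ∃ t ∈ 𝓝 x, LipschitzOnWith K (g ∘ f) t := by
  obtain ⟨K, t, ht, hK⟩ := hg
  obtain ⟨L, s, hs, hL⟩ := hf
  have hc : ContinuousAt f x := hL.continuousOn.continuousAt hs
  exact ⟨K * L, s ∩ f ⁻¹' t, inter_mem hs (hc.preimage_mem_nhds ht),
    hK.comp (hL.mono Set.inter_subset_left) fun y hy ↦ hy.2⟩

variable {n : ℕ} {M : Type*}

section

variable [TopologicalSpace M] [ChartedSpace (EuclideanSpace ℝ (Fin n)) M]

theorem LipschitzInChartAt.comp₂ {f g : M → ℝ} {x : M} {F : ℝ × ℝ → ℝ}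
    (hf : LipschitzInChartAt n f x) (hg : LipschitzInChartAt n g x)
    (hF : ∃ K, ∃ t ∈ 𝓝 (f x, g x), LipschitzOnWith K F t) :
    LipschitzInChartAt n (fun z ↦ F (f z, g z)) x := by
  set e := chartAt (EuclideanSpace ℝ (Fin n)) x
  have hex : e.symm (e x) = x := e.left_inv (mem_chart_source _ x)
  have hF' : ∃ K, ∃ t ∈ 𝓝 ((f ∘ e.symm) (e x), (g ∘ e.symm) (e x)), LipschitzOnWith K F t := by
    rwa [Function.comp_apply, Function.comp_apply, hex]
  refine exists_lipschitzOnWith_comp (g := F) (f := fun y ↦ ((f ∘ e.symm) y, (g ∘ e.symm) y))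
    hF' ?_
  obtain ⟨K, t, ht, hK⟩ := hf
  obtain ⟨L, s, hs, hL⟩ := hg
  exact ⟨max K L, t ∩ s, inter_mem ht hs,
    (hK.mono Set.inter_subset_left).prodMk (hL.mono Set.inter_subset_right)⟩

theorem LipschitzInChartAt.continuousAt {f : M → ℝ} {x : M} (hf : LipschitzInChartAt n f x) :
    ContinuousAt f x := by
  obtain ⟨K, t, ht, hK⟩ := hf
  rw [(chartAt (EuclideanSpace ℝ (Fin n)) x).symm.continuousAt_iff_continuousAt_comp_right
    (x := x) (mem_chart_source _ x)]
  exact hK.continuousOn.continuousAt ht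

theorem LipschitzInChartAt.congr {f g : M → ℝ} {x : M} (hf : LipschitzInChartAt n f x)
    (h : f =ᶠ[𝓝 x] g) : LipschitzInChartAt n g x := by
  obtain ⟨K, t, ht, hK⟩ := hf
  set e := chartAt (EuclideanSpace ℝ (Fin n)) x
  have hx := mem_chart_source (EuclideanSpace ℝ (Fin n)) x
  have hc : Tendsto e.symm (𝓝 (e x)) (𝓝 x) := by
    simpa [ContinuousAt, e.left_inv hx] using e.continuousAt_symm (e.map_source hx)
  refine ⟨K, _, inter_mem ht (hc.eventually h), ?_⟩
  intro y hy z hz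
  have h1 : (f ∘ e.symm) y = (g ∘ e.symm) y := hy.2
  have h2 : (f ∘ e.symm) z = (g ∘ e.symm) z := hz.2
  rw [← h1, ← h2]
  exact hK hy.1 hz.1

variable [IsManifold (𝓡 n) 1 M]

theorem contMDiffAt_lipschitzInChartAt {f : M → ℝ} {x : M}
    (hf : ContMDiffAt (𝓡 n) 𝓘(ℝ, ℝ) 1 f x) : LipschitzInChartAt n f x := by
  have h := contMDiffAt_symm_of_mem_maximalAtlas (I := 𝓡 n) (n := 1)
    (IsManifold.chart_mem_maximalAtlas x) ((chartAt (EuclideanSpace ℝ (Fin n)) x).map_source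
      (mem_chart_source _ x))
  have h2 : ContMDiffAt (𝓡 n) 𝓘(ℝ, ℝ) 1 f ((chartAt (EuclideanSpace ℝ (Fin n)) x).symm
      (chartAt (EuclideanSpace ℝ (Fin n)) x x)) := by
    rwa [(chartAt (EuclideanSpace ℝ (Fin n)) x).left_inv (mem_chart_source _ x)]
  exact (contMDiffAt_iff_contDiffAt.1 (h2.comp _ h)).exists_lipschitzOnWith

/-- A function which is Lipschitz near `x` in the preferred chart at `x` is Lipschitz near `x` in
any other chart. -/
theorem LipschitzInChartAt.exists_lipschitzOnWith {f : M → ℝ} {x x₀ : M}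
    (hf : LipschitzInChartAt n f x) (hx : x ∈ (chartAt (EuclideanSpace ℝ (Fin n)) x₀).source) :
    ∃ K, ∃ t ∈ 𝓝 (chartAt (EuclideanSpace ℝ (Fin n)) x₀ x),
      LipschitzOnWith K (f ∘ (chartAt (EuclideanSpace ℝ (Fin n)) x₀).symm) t := by
  set e := chartAt (EuclideanSpace ℝ (Fin n)) x₀
  set e' := chartAt (EuclideanSpace ℝ (Fin n)) x with he'
  have hex : e.symm (e x) = x := e.left_inv hx
  have hxs : x ∈ e'.source := mem_chart_source _ x
  have h1 : ContMDiffAt (𝓡 n) (𝓡 n) 1 (e' ∘ e.symm) (e x) := by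
    refine ContMDiffAt.comp (I' := 𝓡 n) (e x) ?_ (contMDiffAt_symm_of_mem_maximalAtlas
      (IsManifold.chart_mem_maximalAtlas x₀) (e.map_source hx))
    rw [hex]
    exact contMDiffAt_of_mem_maximalAtlas (IsManifold.chart_mem_maximalAtlas x) hxs
  have h2 := (contMDiffAt_iff_contDiffAt.1 h1).exists_lipschitzOnWith
  have h3 : ∃ K, ∃ t ∈ 𝓝 ((e' ∘ e.symm) (e x)), LipschitzOnWith K (f ∘ e'.symm) t := by
    rw [Function.comp_apply, hex]
    exact hf
  obtain ⟨K, t, ht, hK⟩ := exists_lipschitzOnWith_comp h3 h2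
  have h4 : e.symm ⁻¹' e'.source ∈ 𝓝 (e x) :=
    (e.continuousAt_symm (e.map_source hx)).preimage_mem_nhds
      (by rw [hex]; exact e'.open_source.mem_nhds hxs)
  refine ⟨K, t ∩ e.symm ⁻¹' e'.source, inter_mem ht h4, fun y hy z hz ↦ ?_⟩
  have h5 := hK hy.1 hz.1
  simpa [e'.left_inv hy.2, e'.left_inv hz.2] using h5

variable [RiemannianBundle (fun x : M ↦ TangentSpace (𝓡 n) x)]
  [IsContinuousRiemannianBundle (EuclideanSpace ℝ (Fin n)) (fun x : M ↦ TangentSpace (𝓡 n) x)]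

theorem LipschitzInChartAt.exists_eventually_norm_riemannianGrad_le {f : M → ℝ} {x : M}
    (hf : LipschitzInChartAt n f x) : ∃ C, ∀ᶠ z in 𝓝 x, ‖riemannianGrad n f z‖ ≤ C := by
  obtain ⟨K, t, ht, hK⟩ := hf
  obtain ⟨C, hC, hCe⟩ := exists_eventually_norm_chartCoframe_le (n := n) x
  set e := chartAt (EuclideanSpace ℝ (Fin n)) x
  have hx := mem_chart_source (EuclideanSpace ℝ (Fin n)) x
  refine ⟨K * C, ?_⟩
  have h1 : ∀ᶠ z in 𝓝 x, t ∈ 𝓝 (e z) :=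
    (e.continuousAt hx).eventually (eventually_mem_nhds_iff.2 ht)
  filter_upwards [hCe, h1, e.open_source.mem_nhds hx] with z hz htz hzs
  refine (norm_riemannianGrad_le hzs f).trans ?_
  gcongr
  exact norm_fderiv_le_of_lipschitzOn ℝ htz hK

/-- Locally Lipschitz functions have bounded gradient on compact sets. -/
theorem exists_norm_riemannianGrad_le {f : M → ℝ} (hf : ∀ x, LipschitzInChartAt n f x) {s : Set M}
    (hs : IsCompact s) : ∃ C, ∀ x ∈ s, ‖riemannianGrad n f x‖ ≤ C := by
  refine hs.induction_on (p := fun s ↦ ∃ C, ∀ x ∈ s, ‖riemannianGrad n f x‖ ≤ C)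
    ⟨0, by simp⟩ (fun s t hst ⟨C, hC⟩ ↦ ⟨C, fun x hx ↦ hC x (hst hx)⟩) ?_ fun x _ ↦ ?_
  · rintro s t ⟨C, hC⟩ ⟨D, hD⟩
    exact ⟨max C D, fun x hx ↦ hx.elim (fun h ↦ (hC x h).trans (le_max_left _ _))
      fun h ↦ (hD x h).trans (le_max_right _ _)⟩
  · obtain ⟨C, hC⟩ := (hf x).exists_eventually_norm_riemannianGrad_le
    exact ⟨_, mem_nhdsWithin_of_mem_nhds hC, C, fun z hz ↦ hz⟩

end

variable [EMetricSpace M] [ChartedSpace (EuclideanSpace ℝ (Fin n)) M] [IsManifold (𝓡 n) 1 M]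
  [RiemannianBundle (fun x : M ↦ TangentSpace (𝓡 n) x)]
  [IsRiemannianManifold (𝓡 n) M]

/-- The chart inverse sends a segment in the ball to a curve of length at most K times the length of
the segment, and the Riemannian distance is at most the length of any such curve. -/
theorem lipschitzOnWith_chartAt_symm {x₀ : M} {c : EuclideanSpace ℝ (Fin n)} {r : ℝ} {K : ℝ≥0}
    (hsub : Metric.ball c r ⊆ (chartAt (EuclideanSpace ℝ (Fin n)) x₀).target)
    (hK : ∀ y ∈ Metric.ball c r,
      ‖chartFrame n x₀ ((chartAt (EuclideanSpace ℝ (Fin n)) x₀).symm y)‖ ≤ K) :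
    LipschitzOnWith K (chartAt (EuclideanSpace ℝ (Fin n)) x₀).symm (Metric.ball c r) := by
  intro y hy z hz
  set e := chartAt (EuclideanSpace ℝ (Fin n)) x₀
  let η : ℝ → EuclideanSpace ℝ (Fin n) := fun t ↦ y + t • (z - y)
  have hη : ∀ t ∈ Set.Icc (0 : ℝ) 1, η t ∈ Metric.ball c r := fun t ht ↦
    (convex_ball c r).add_smul_sub_mem hy hz ht
  have hηd (t : ℝ) : HasDerivAt η (z - y) t := by
    have := ((hasDerivAt_id t).smul_const (z - y)).const_add y
    rwa [one_smul] at this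
  have hηs : ContMDiff 𝓘(ℝ, ℝ) (𝓡 n) 1 η := by
    rw [contMDiff_iff_contDiff]; fun_prop
  have hesymm : ContMDiffOn (𝓡 n) (𝓡 n) 1 e.symm e.target :=
    contMDiffOn_symm_of_mem_maximalAtlas (IsManifold.chart_mem_maximalAtlas x₀)
  have hγ : ContMDiffOn 𝓘(ℝ, ℝ) (𝓡 n) 1 (e.symm ∘ η) (Set.Icc 0 1) :=
    hesymm.comp hηs.contMDiffOn fun t ht ↦ hsub (hη t ht)
  rw [IsRiemannianManifold.out (I := 𝓡 n) (e.symm y) (e.symm z)]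
  refine (riemannianEDist_le_pathELength hγ (by simp [η]) (by simp [η]) zero_le_one).trans ?_
  rw [pathELength_eq_lintegral_mfderiv_Icc]
  have hbound : ∀ t ∈ Set.Icc (0 : ℝ) 1,
      ‖mfderiv 𝓘(ℝ, ℝ) (𝓡 n) (e.symm ∘ η) t (1 : ℝ)‖ₑ ≤ K * edist y z := by
    intro t ht
    have h1 : mfderiv 𝓘(ℝ, ℝ) (𝓡 n) (e.symm ∘ η) t =
        (mfderiv (𝓡 n) (𝓡 n) e.symm (η t)).comp (mfderiv 𝓘(ℝ, ℝ) (𝓡 n) η t) :=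
      mfderiv_comp t (mdifferentiableAt_atlas_symm (chart_mem_atlas _ x₀) (hsub (hη t ht)))
        (hηs.mdifferentiable one_ne_zero t)
    have h2 : mfderiv 𝓘(ℝ, ℝ) (𝓡 n) η t (1 : ℝ) = z - y := by
      rw [mfderiv_eq_fderiv]
      rw [(hηd t).hasFDerivAt.fderiv]
      exact one_smul ℝ (z - y)
    have h3 : mfderiv 𝓘(ℝ, ℝ) (𝓡 n) (e.symm ∘ η) t (1 : ℝ) =
        chartFrame n x₀ (e.symm (η t)) (z - y) := by
      rw [h1, ← h2, ← mfderiv_chartAt_symm (hsub (hη t ht))]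
      rfl
    have h4 : ‖chartFrame n x₀ (e.symm (η t)) (z - y)‖ ≤ K * ‖z - y‖ :=
      (ContinuousLinearMap.le_opNorm _ _).trans
        (mul_le_mul_of_nonneg_right (hK _ (hη t ht)) (norm_nonneg _))
    have h5 : ‖mfderiv 𝓘(ℝ, ℝ) (𝓡 n) (e.symm ∘ η) t (1 : ℝ)‖ₑ =
        ‖chartFrame n x₀ (e.symm (η t)) (z - y)‖ₑ := congrArg _ h3
    rw [h5, edist_comm, edist_eq_enorm_sub, ← ofReal_norm, ← ofReal_norm,
      ← ENNReal.ofReal_coe_nnreal, ← ENNReal.ofReal_mul K.coe_nonneg]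
    exact ENNReal.ofReal_le_ofReal h4
  calc _ ≤ ∫⁻ _ in Set.Icc (0 : ℝ) 1, K * edist y z := setLIntegral_mono measurable_const hbound
    _ = K * edist y z := by simp

theorem LocallyLipschitz.lipschitzInChartAt
    [IsContinuousRiemannianBundle (EuclideanSpace ℝ (Fin n)) (fun x : M ↦ TangentSpace (𝓡 n) x)]
    {f : M → ℝ} (hf : LocallyLipschitz f) (x : M) :
    LipschitzInChartAt n f x := by
  set e := chartAt (EuclideanSpace ℝ (Fin n)) x with he
  have hx : x ∈ e.source := mem_chart_source _ x
  have hex : e.symm (e x) = x := e.left_inv hx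
  obtain ⟨K, hK, hKe⟩ := exists_eventually_norm_chartFrame_le (n := n) x
  lift K to ℝ≥0 using hK.le
  have hc : Tendsto e.symm (𝓝 (e x)) (𝓝 x) := by
    simpa [ContinuousAt, hex] using e.continuousAt_symm (e.map_source hx)
  obtain ⟨r, hr, hball⟩ := Metric.eventually_nhds_iff_ball.1
    ((hc.eventually hKe).and (e.open_target.mem_nhds (e.map_source hx)))
  have hsymm := lipschitzOnWith_chartAt_symm (x₀ := x) (c := e x) (r := r) (K := K)
    (fun y hy ↦ (hball y hy).2) (fun y hy ↦ (hball y hy).1)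
  exact exists_lipschitzOnWith_comp (by simpa [hex] using hf x)
    ⟨K, _, Metric.ball_mem_nhds _ hr, hsymm⟩

end

/-! ### Transfer of functions between the manifold and the model space. -/

section

open Topology Filter
open scoped NNReal

variable {n : ℕ} {M : Type*} [TopologicalSpace M] [ChartedSpace (EuclideanSpace ℝ (Fin n)) M]
  [T2Space M]

/-- A function `f` read in the chart at `x₀`, extended by zero. -/
noncomputable def chartRep (n : ℕ) {M : Type*} [TopologicalSpace M]
    [ChartedSpace (EuclideanSpace ℝ (Fin n)) M] (x₀ : M) (f : M → ℝ) :
    EuclideanSpace ℝ (Fin n) → ℝ :=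
  (chartAt (EuclideanSpace ℝ (Fin n)) x₀).target.indicator
    (f ∘ (chartAt (EuclideanSpace ℝ (Fin n)) x₀).symm)

/-- A function `g` on the model space pulled back by the chart at `x₀`, extended by zero. -/
noncomputable def chartPullback {n : ℕ} {M : Type*} [TopologicalSpace M]
    [ChartedSpace (EuclideanSpace ℝ (Fin n)) M] (x₀ : M) (g : EuclideanSpace ℝ (Fin n) → ℝ) :
    M → ℝ :=
  (chartAt (EuclideanSpace ℝ (Fin n)) x₀).source.indicator
    (g ∘ chartAt (EuclideanSpace ℝ (Fin n)) x₀)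

omit [T2Space M] in
theorem chartRep_eventuallyEq {x₀ : M} (f : M → ℝ) {y : EuclideanSpace ℝ (Fin n)}
    (hy : y ∈ (chartAt (EuclideanSpace ℝ (Fin n)) x₀).target) :
    chartRep n x₀ f =ᶠ[𝓝 y] f ∘ (chartAt (EuclideanSpace ℝ (Fin n)) x₀).symm := by
  filter_upwards [(chartAt (EuclideanSpace ℝ (Fin n)) x₀).open_target.mem_nhds hy] with z hz
  simp [chartRep, hz]

omit [T2Space M] in
theorem chartPullback_comp_symm_eventuallyEq {x₀ x : M} (g : EuclideanSpace ℝ (Fin n) → ℝ)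
    (hx : x ∈ (chartAt (EuclideanSpace ℝ (Fin n)) x₀).source) :
    chartPullback x₀ g ∘ (chartAt (EuclideanSpace ℝ (Fin n)) x₀).symm
      =ᶠ[𝓝 (chartAt (EuclideanSpace ℝ (Fin n)) x₀ x)] g := by
  set e := chartAt (EuclideanSpace ℝ (Fin n)) x₀
  filter_upwards [e.open_target.mem_nhds (e.map_source hx)] with z hz
  simp only [Function.comp_apply, chartPullback]
  rw [Set.indicator_of_mem (e.map_target hz), Function.comp_apply]
  exact congrArg g (e.right_inv hz)

omit [T2Space M] in
theorem tsupport_chartRep_subset {x₀ : M} {f : M → ℝ} (hc : HasCompactSupport f)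
    (hs : tsupport f ⊆ (chartAt (EuclideanSpace ℝ (Fin n)) x₀).source) :
    IsCompact (chartAt (EuclideanSpace ℝ (Fin n)) x₀ '' tsupport f) ∧
      tsupport (chartRep n x₀ f) ⊆ chartAt (EuclideanSpace ℝ (Fin n)) x₀ '' tsupport f := by
  set e := chartAt (EuclideanSpace ℝ (Fin n)) x₀
  have hK : IsCompact (e '' tsupport f) := hc.isCompact.image_of_continuousOn (e.continuousOn.mono hs)
  refine ⟨hK, closure_minimal (fun y hy ↦ ?_) hK.isClosed⟩
  have hyt : y ∈ e.target := Set.mem_of_indicator_ne_zero hy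
  refine ⟨e.symm y, subset_tsupport _ ?_, e.right_inv hyt⟩
  have h1 : chartRep n x₀ f y ≠ 0 := hy
  rwa [chartRep, Set.indicator_of_mem hyt] at h1

/-- The image of `K` is compact, hence closed because M is Hausdorff. So the extension by zero
vanishes near every point outside the chart, and smoothness is preserved. -/
theorem tsupport_chartPullback_subset {x₀ : M} {g : EuclideanSpace ℝ (Fin n) → ℝ}
    {K : Set (EuclideanSpace ℝ (Fin n))} (hK : IsCompact K) (hg : tsupport g ⊆ K)
    (hs : K ⊆ (chartAt (EuclideanSpace ℝ (Fin n)) x₀).target) :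
    IsCompact ((chartAt (EuclideanSpace ℝ (Fin n)) x₀).symm '' K) ∧
      tsupport (chartPullback x₀ g) ⊆ (chartAt (EuclideanSpace ℝ (Fin n)) x₀).symm '' K := by
  set e := chartAt (EuclideanSpace ℝ (Fin n)) x₀
  have hK' : IsCompact (e.symm '' K) := hK.image_of_continuousOn (e.continuousOn_symm.mono hs)
  refine ⟨hK', closure_minimal (fun x hx ↦ ?_) hK'.isClosed⟩
  have hxs : x ∈ e.source := Set.mem_of_indicator_ne_zero hx
  refine ⟨e x, hg (subset_tsupport _ ?_), e.left_inv hxs⟩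
  have h1 : chartPullback x₀ g x ≠ 0 := hx
  rwa [chartPullback, Set.indicator_of_mem hxs] at h1

variable [IsManifold (𝓡 n) ∞ M]

omit [T2Space M] in
theorem exists_lipschitzWith_chartRep {x₀ : M} {f : M → ℝ} (hf : ∀ x, LipschitzInChartAt n f x)
    (hc : HasCompactSupport f)
    (hs : tsupport f ⊆ (chartAt (EuclideanSpace ℝ (Fin n)) x₀).source) :
    ∃ L, LipschitzWith L (chartRep n x₀ f) := by
  set e := chartAt (EuclideanSpace ℝ (Fin n)) x₀
  obtain ⟨hK, hsub⟩ := tsupport_chartRep_subset hc hs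
  refine lipschitzWith_of_hasCompactSupport (fun y ↦ ?_) (hK.of_isClosed_subset
    (isClosed_tsupport _) hsub)
  by_cases hy : y ∈ e.target
  · have h1 := (hf (e.symm y)).exists_lipschitzOnWith (x₀ := x₀) (e.map_target hy)
    have h2 : e (e.symm y) = y := e.right_inv hy
    rw [h2] at h1
    obtain ⟨K, t, ht, hL⟩ := h1
    refine ⟨K, t ∩ e.target, inter_mem ht (e.open_target.mem_nhds hy), fun a ha b hb ↦ ?_⟩
    simpa [chartRep, ha.2, hb.2, e] using hL ha.1 hb.1
  · have h1 : y ∉ tsupport (chartRep n x₀ f) := fun h ↦ by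
      obtain ⟨z, hz, rfl⟩ := hsub h
      exact hy (e.map_source (hs hz))
    refine ⟨0, _, (isClosed_tsupport _).isOpen_compl.mem_nhds h1, fun a ha b hb ↦ ?_⟩
    rw [image_eq_zero_of_notMem_tsupport ha, image_eq_zero_of_notMem_tsupport hb]
    simp

theorem contMDiff_chartPullback {x₀ : M} {g : EuclideanSpace ℝ (Fin n) → ℝ}
    (hg : ContDiff ℝ ∞ g) {K : Set (EuclideanSpace ℝ (Fin n))} (hK : IsCompact K)
    (hgK : tsupport g ⊆ K) (hs : K ⊆ (chartAt (EuclideanSpace ℝ (Fin n)) x₀).target) :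
    ContMDiff (𝓡 n) 𝓘(ℝ, ℝ) ∞ (chartPullback x₀ g) := by
  obtain ⟨hK', hsub⟩ := tsupport_chartPullback_subset hK hgK hs
  set e := chartAt (EuclideanSpace ℝ (Fin n)) x₀
  intro x
  by_cases hx : x ∈ e.source
  · have h1 : ContMDiffAt (𝓡 n) 𝓘(ℝ, ℝ) ∞ (g ∘ e) x :=
      hg.contMDiff.contMDiffAt.comp x (contMDiffAt_of_mem_maximalAtlas
        (IsManifold.chart_mem_maximalAtlas x₀) hx)
    refine h1.congr_of_eventuallyEq ?_
    filter_upwards [e.open_source.mem_nhds hx] with z hz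
    exact Set.indicator_of_mem hz _
  · have h1 : x ∉ tsupport (chartPullback x₀ g) := fun h ↦ by
      obtain ⟨z, hz, rfl⟩ := hsub h
      exact hx (e.map_target (hs hz))
    exact contMDiffAt_const.congr_of_eventuallyEq (notMem_tsupport_iff_eventuallyEq.1 h1)

variable [RiemannianBundle (fun x : M ↦ TangentSpace (𝓡 n) x)]
  [MeasurableSpace M] [BorelSpace M]

omit [T2Space M] in
/-- Rademacher's theorem for functions supported in a chart. -/
theorem ae_mdifferentiableAt_of_tsupport_subset {x₀ : M} {f : M → ℝ}
    (hf : ∀ x, LipschitzInChartAt n f x) (hc : HasCompactSupport f)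
    (hs : tsupport f ⊆ (chartAt (EuclideanSpace ℝ (Fin n)) x₀).source) :
    ∀ᵐ x ∂(riemannianVolume n M), MDifferentiableAt (𝓡 n) 𝓘(ℝ, ℝ) f x := by
  obtain ⟨L, hL⟩ := exists_lipschitzWith_chartRep hf hc hs
  filter_upwards [riemannianVolume_ae_of_chart (chart_mem_atlas _ x₀)
    hL.ae_differentiableAt] with x hx
  by_cases hxs : x ∈ (chartAt (EuclideanSpace ℝ (Fin n)) x₀).source
  · rw [mdifferentiableAt_iff_chart hxs]
    exact (hx hxs).congr_of_eventuallyEq (chartRep_eventuallyEq f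
      ((chartAt (EuclideanSpace ℝ (Fin n)) x₀).map_source hxs)).symm
  · have h1 : x ∉ tsupport f := fun h ↦ hxs (hs h)
    exact (mdifferentiableAt_const (c := (0 : ℝ))).congr_of_eventuallyEq
      (notMem_tsupport_iff_eventuallyEq.1 h1)

variable [IsContinuousRiemannianBundle (EuclideanSpace ℝ (Fin n))
  (fun x : M ↦ TangentSpace (𝓡 n) x)]

omit [T2Space M] in
theorem integrable_inner_riemannianGrad [SecondCountableTopology M] {ρ f : M → ℝ} {U : Set M}
    (hρ : ∀ᵐ x ∂(riemannianVolume n M), x ∈ U → ‖riemannianGrad n ρ x‖ ≤ 1)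
    (hf : ∀ x, LipschitzInChartAt n f x) (hc : HasCompactSupport f) (hU : tsupport f ⊆ U) :
    Integrable (fun x ↦ (inner ℝ (riemannianGrad n ρ x) (riemannianGrad n f x) : ℝ))
      (riemannianVolume n M) := by
  obtain ⟨B, hB⟩ := exists_norm_riemannianGrad_le hf hc.isCompact
  have hint : IntegrableOn (fun _ ↦ B) (tsupport f) (riemannianVolume n M) :=
    integrableOn_const hc.isCompact.measure_lt_top.ne
  refine (hint.integrable_indicator (isClosed_tsupport f).measurableSet).mono'
    (aemeasurable_inner_riemannianGrad ρ f _).aestronglyMeasurable ?_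
  filter_upwards [hρ] with x hx
  by_cases hxs : x ∈ tsupport f
  · rw [Set.indicator_of_mem hxs]
    refine (norm_inner_le_norm _ _).trans ?_
    have := hB x hxs
    have := hx (hU hxs)
    nlinarith [norm_nonneg (riemannianGrad n ρ x), norm_nonneg (riemannianGrad n f x)]
  · rw [Set.indicator_of_notMem hxs, riemannianGrad_eq_zero_of_notMem_tsupport hxs]
    simp

omit [ChartedSpace (EuclideanSpace ℝ (Fin n)) M] [T2Space M] [MeasurableSpace M] [BorelSpace M]
  [IsManifold (𝓡 n) ∞ M] [RiemannianBundle (fun x : M ↦ TangentSpace (𝓡 n) x)]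
  [IsContinuousRiemannianBundle (EuclideanSpace ℝ (Fin n)) (fun x : M ↦ TangentSpace (𝓡 n) x)] in
theorem ContinuousOn.continuous_mul_of_tsupport_subset {w f : M → ℝ} {U : Set M} (hU : IsOpen U)
    (hw : ContinuousOn w U) (hf : Continuous f) (hs : tsupport f ⊆ U) :
    Continuous fun x ↦ w x * f x :=
  continuous_of_tsupport fun _ hx ↦
    (hw.continuousAt (hU.mem_nhds (hs (tsupport_mul_subset_right hx)))).mul hf.continuousAt

end

/-! ### Lipschitz test functions in the distributional inequality. -/

section

open Topology Filter
open scoped NNReal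

variable {n : ℕ} {M : Type*} [TopologicalSpace M] [ChartedSpace (EuclideanSpace ℝ (Fin n)) M]
  [T2Space M] [IsManifold (𝓡 n) ∞ M] [RiemannianBundle (fun x : M ↦ TangentSpace (𝓡 n) x)]
  [MeasurableSpace M] [BorelSpace M]
  [IsContinuousRiemannianBundle (EuclideanSpace ℝ (Fin n)) (fun x : M ↦ TangentSpace (𝓡 n) x)]
  [SecondCountableTopology M]

/-- The distributional inequality holds for Lipschitz test functions with small support. -/
theorem DistribLaplacianGE.of_tsupport_subset_chart {ρ w : M → ℝ} {U : Set M}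
    (h : DistribLaplacianGE n U ρ w) (hw : ContinuousOn w U)
    (hρ : ∀ᵐ x ∂(riemannianVolume n M), x ∈ U → ‖riemannianGrad n ρ x‖ ≤ 1)
    {x₀ : M} {V : Set M} (hV : IsOpen V) (hVU : V ⊆ U)
    (hVs : V ⊆ (chartAt (EuclideanSpace ℝ (Fin n)) x₀).source) {B : ℝ}
    (hB : ∀ x ∈ V, ‖chartCoframe n x₀ x‖ ≤ B)
    {ψ : M → ℝ} (hψ : ∀ x, LipschitzInChartAt n ψ x) (hc : HasCompactSupport ψ)
    (hs : tsupport ψ ⊆ V) (h0 : ∀ x, 0 ≤ ψ x) :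
    ∫ x, w x * ψ x ∂(riemannianVolume n M) ≤
      -∫ x, inner ℝ (riemannianGrad n ρ x) (riemannianGrad n ψ x) ∂(riemannianVolume n M) := by
  set e := chartAt (EuclideanSpace ℝ (Fin n)) x₀
  set f := chartRep n x₀ ψ with hfdef
  have hss : tsupport ψ ⊆ e.source := hs.trans hVs
  obtain ⟨L, hL⟩ := exists_lipschitzWith_chartRep hψ hc hss
  obtain ⟨hK, hfK⟩ := tsupport_chartRep_subset hc hss
  have hf0 (y) : 0 ≤ f y := Set.indicator_nonneg (fun _ _ ↦ h0 _) y
  have hfe (x) (hx : x ∈ e.source) : f (e x) = ψ x := by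
    rw [hfdef, chartRep, Set.indicator_of_mem (e.map_source hx), Function.comp_apply,
      e.left_inv hx]
  -- a compact neighborhood of the support in the chart
  have hV' : IsOpen (e.target ∩ e.symm ⁻¹' V) := e.isOpen_inter_preimage_symm hV
  have hKV : e '' tsupport ψ ⊆ e.target ∩ e.symm ⁻¹' V := by
    rintro _ ⟨x, hx, rfl⟩
    refine ⟨e.map_source (hss hx), ?_⟩
    rw [Set.mem_preimage, e.left_inv (hss hx)]
    exact hs hx
  obtain ⟨δ, hδ, hδV⟩ := hK.exists_cthickening_subset_open hV' hKV
  set K := Metric.cthickening δ (e '' tsupport ψ)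
  have hKc : IsCompact K := hK.cthickening
  have hKt : K ⊆ e.target := hδV.trans Set.inter_subset_left
  set S := e.symm '' K with hS
  have hSc : IsCompact S := hKc.image_of_continuousOn (e.continuousOn_symm.mono hKt)
  have hSV : S ⊆ V := by
    rintro _ ⟨y, hy, rfl⟩
    exact (hδV hy).2
  -- the approximations
  obtain ⟨g, hgs, hg0, hgL, hgd, hgt, hgf⟩ :=
    hL.exists_smooth_approx (μ := (volume : Measure (EuclideanSpace ℝ (Fin n)))) hf0
  have hsmall : ∀ᶠ k : ℕ in atTop, 1 / ((k : ℝ) + 1) ≤ δ :=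
    tendsto_one_div_add_atTop_nhds_zero_nat.eventually (Iic_mem_nhds hδ)
  have hgK : ∀ᶠ k : ℕ in atTop, tsupport (g k) ⊆ K := by
    filter_upwards [hsmall] with k hk
    exact (hgt k).trans ((Metric.cthickening_mono hk _).trans
      (Metric.cthickening_subset_of_subset _ hfK))
  let Ψ (k : ℕ) : M → ℝ := chartPullback x₀ (g k)
  have hΨS : ∀ᶠ k : ℕ in atTop, tsupport (Ψ k) ⊆ S := by
    filter_upwards [hgK] with k hk
    exact (tsupport_chartPullback_subset hKc hk hKt).2
  have hΨtest : ∀ᶠ k : ℕ in atTop, IsTestFunction n U (Ψ k) := by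
    filter_upwards [hgK, hΨS] with k hk hkS
    exact ⟨contMDiff_chartPullback (hgs k) hKc hk hKt,
      hSc.of_isClosed_subset (isClosed_tsupport _) hkS, hkS.trans (hSV.trans hVU)⟩
  have hΨ0 (k) (x) : 0 ≤ Ψ k x := Set.indicator_nonneg (fun _ _ ↦ hg0 k _) x
  have hΨe (k) (x) (hx : x ∈ e.source) : Ψ k x = g k (e x) := Set.indicator_of_mem hx _
  have hψ_zero (x) (hx : x ∉ e.source) : ψ x = 0 :=
    image_eq_zero_of_notMem_tsupport fun hx' ↦ hx (hss hx')
  have hgrad (k) (x) (hx : x ∈ e.source) :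
      fderiv ℝ (Ψ k ∘ e.symm) (e x) = fderiv ℝ (g k) (e x) :=
    (chartPullback_comp_symm_eventuallyEq (g k) hx).fderiv_eq
  have hΨdist (k) (x) : |Ψ k x - ψ x| ≤ L * (1 / ((k : ℝ) + 1)) := by
    by_cases hx : x ∈ e.source
    · rw [hΨe k x hx, ← hfe x hx]
      exact hgd k (e x)
    · have : Ψ k x = 0 := Set.indicator_of_notMem hx _
      rw [this, hψ_zero x hx, sub_zero, abs_zero]
      positivity
  have hψcont : Continuous ψ := continuous_iff_continuousAt.2 fun x ↦ (hψ x).continuousAt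
  -- The convergence of Ψ is uniform, and all supports eventually lie in the compact set S, on which
  -- `w` is bounded.
  have hlim1 : Tendsto (fun k ↦ ∫ x, w x * Ψ k x ∂(riemannianVolume n M)) atTop
      (𝓝 (∫ x, w x * ψ x ∂(riemannianVolume n M))) := by
    obtain ⟨Cw, hCw⟩ := hSc.exists_bound_of_continuousOn (hw.mono (hSV.trans hVU))
    obtain ⟨Cψ, hCψ⟩ := hc.exists_bound_of_continuous hψcont
    have hint : IntegrableOn (fun _ ↦ Cw * (Cψ + L)) S (riemannianVolume n M) :=
      integrableOn_const hSc.measure_lt_top.ne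
    refine tendsto_integral_filter_of_dominated_convergence _ ?_ ?_
      (hint.integrable_indicator hSc.isClosed.measurableSet) ?_
    · filter_upwards [hΨtest, hΨS]
        with k hk hkS
      have hcont : Continuous fun x ↦ w x * Ψ k x :=
        (hw.mono hVU).continuous_mul_of_tsupport_subset hV hk.contMDiff.continuous
          (hkS.trans hSV)
      exact hcont.aestronglyMeasurable
    · filter_upwards [hΨS] with k hkS
      refine Eventually.of_forall fun x ↦ ?_
      by_cases hx : x ∈ S
      · rw [Set.indicator_of_mem hx, norm_mul]
        have h1 := hCw x hx
        have h2 : ‖Ψ k x‖ ≤ Cψ + L := by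
          have h3 : |Ψ k x - ψ x| ≤ L := (hΨdist k x).trans (mul_le_of_le_one_right L.coe_nonneg
            ((div_le_one (by positivity)).2 (by linarith [(Nat.cast_nonneg k : (0 : ℝ) ≤ k)])))
          have h4 := hCψ x
          have h5 := norm_add_le (ψ x) (Ψ k x - ψ x)
          rw [add_sub_cancel] at h5
          exact h5.trans (add_le_add h4 h3)
        exact mul_le_mul h1 h2 (norm_nonneg _) ((norm_nonneg _).trans h1)
      · rw [Set.indicator_of_notMem hx,
          image_eq_zero_of_notMem_tsupport fun hx' ↦ hx (hkS hx'), mul_zero, norm_zero]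
    · refine Eventually.of_forall fun x ↦ Tendsto.const_mul _ ?_
      refine tendsto_iff_norm_sub_tendsto_zero.2 (squeeze_zero (fun _ ↦ norm_nonneg _)
        (fun k ↦ hΨdist k x) ?_)
      simpa using tendsto_one_div_add_atTop_nhds_zero_nat.const_mul (L : ℝ)
  have hlim2 : Tendsto (fun k ↦ ∫ x, inner ℝ (riemannianGrad n ρ x) (riemannianGrad n (Ψ k) x)
      ∂(riemannianVolume n M)) atTop (𝓝 (∫ x, inner ℝ (riemannianGrad n ρ x)
        (riemannianGrad n ψ x) ∂(riemannianVolume n M))) := by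
    have hint : IntegrableOn (fun _ ↦ L * B) S (riemannianVolume n M) :=
      integrableOn_const hSc.measure_lt_top.ne
    refine tendsto_integral_filter_of_dominated_convergence _
      (Eventually.of_forall fun k ↦
        (aemeasurable_inner_riemannianGrad ρ (Ψ k) _).aestronglyMeasurable) ?_
      (hint.integrable_indicator hSc.isClosed.measurableSet) ?_
    · filter_upwards [hΨS] with k hkS
      filter_upwards [hρ] with x hx
      by_cases hxS : x ∈ S
      · rw [Set.indicator_of_mem hxS]
        have h1 : ‖riemannianGrad n (Ψ k) x‖ ≤ L * B := by
          refine (norm_riemannianGrad_le (hVs (hSV hxS)) (Ψ k)).trans ?_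
          rw [hgrad k x (hVs (hSV hxS))]
          exact mul_le_mul (hgL k _) (hB x (hSV hxS))
            (ContinuousLinearMap.opNorm_nonneg _) L.coe_nonneg
        refine (norm_inner_le_norm _ _).trans ?_
        have h2 := hx (hVU (hSV hxS))
        nlinarith [norm_nonneg (riemannianGrad n ρ x), norm_nonneg (riemannianGrad n (Ψ k) x)]
      · rw [Set.indicator_of_notMem hxS,
          riemannianGrad_eq_zero_of_notMem_tsupport fun hx' ↦ hxS (hkS hx')]
        simp
    · filter_upwards [riemannianVolume_ae_of_chart (chart_mem_atlas _ x₀) hgf] with x hx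
      by_cases hxs : x ∈ e.source
      -- By symmetry, ⟨∇ρ, ∇Ψ⟩ is the coordinate derivative of Ψ applied to the coframe image of
      -- ∇ρ(x), a vector independent of k. Convergence of the derivatives at `e x` is then enough.
      · simp_rw [real_inner_comm _ (riemannianGrad n ρ x)]
        simp only [inner_riemannianGrad_chart (x₀ := x₀) hxs]
        have h1 : fderiv ℝ (ψ ∘ e.symm) (e x) = fderiv ℝ f (e x) :=
          (chartRep_eventuallyEq ψ (e.map_source hxs)).symm.fderiv_eq
        have h2 : Tendsto (fun k ↦ fderiv ℝ (Ψ k ∘ e.symm) (e x)) atTop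
            (𝓝 (fderiv ℝ (ψ ∘ e.symm) (e x))) := by
          simp only [hgrad _ x hxs, h1]
          exact hx hxs
        exact ((ContinuousLinearMap.apply ℝ ℝ
          (chartCoframe n x₀ x (riemannianGrad n ρ x))).continuous.tendsto _).comp h2
      · have h1 : riemannianGrad n ψ x = 0 :=
          riemannianGrad_eq_zero_of_notMem_tsupport fun hx' ↦ hxs (hss hx')
        refine tendsto_const_nhds.congr' ?_
        filter_upwards [hΨS] with k hkS
        have h2 : riemannianGrad n (Ψ k) x = 0 :=
          riemannianGrad_eq_zero_of_notMem_tsupport fun hx' ↦ hxs (hVs (hSV (hkS hx')))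
        rw [h1, h2]
  refine le_of_tendsto_of_tendsto hlim1 hlim2.neg ?_
  filter_upwards [hΨtest] with k hk
  exact h (Ψ k) hk (hΨ0 k)

/-- A distributional lower bound for the Laplacian may be tested against Lipschitz functions. -/
theorem DistribLaplacianGE.of_lipschitzInChartAt {ρ w : M → ℝ} {U : Set M}
    (h : DistribLaplacianGE n U ρ w) (hU : IsOpen U) (hw : ContinuousOn w U)
    (hρ : ∀ᵐ x ∂(riemannianVolume n M), x ∈ U → ‖riemannianGrad n ρ x‖ ≤ 1)
    {ψ : M → ℝ} (hψ : ∀ x, LipschitzInChartAt n ψ x) (hc : HasCompactSupport ψ)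
    (hs : tsupport ψ ⊆ U) (h0 : ∀ x, 0 ≤ ψ x) :
    ∫ x, w x * ψ x ∂(riemannianVolume n M) ≤
      -∫ x, inner ℝ (riemannianGrad n ρ x) (riemannianGrad n ψ x) ∂(riemannianVolume n M) := by
  have : LocallyCompactSpace M := Manifold.locallyCompact_of_finiteDimensional (𝓡 n)
  choose B _ hB using fun x : M ↦ exists_eventually_norm_chartCoframe_le (n := n) x
  -- Each V x lies in a chart domain on which the coframe is bounded; that bound controls the
  -- gradients of the mollified functions.
  choose V hVsub hVo hxV using fun x : M ↦ mem_nhds_iff.1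
    (inter_mem (hB x) (chart_source_mem_nhds (EuclideanSpace ℝ (Fin n)) x))
  obtain ⟨χ, hχ⟩ := SmoothPartitionOfUnity.exists_isSubordinate (𝓡 n) (isClosed_univ (X := M)) V
    hVo fun x _ ↦ Set.mem_iUnion.2 ⟨x, hxV x⟩
  have hfin : {i | (Function.support (χ i) ∩ tsupport ψ).Nonempty}.Finite :=
    χ.locallyFinite.finite_nonempty_inter_compact hc.isCompact
  set s := hfin.toFinset with hsdef
  have hsum (x : M) : ∑ i ∈ s, χ i x * ψ x = ψ x := by
    by_cases hx : x ∈ tsupport ψ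
    · rw [← Finset.sum_mul]
      have h1 : ∑ i ∈ s, χ i x = 1 := by
        rw [← χ.sum_eq_one (Set.mem_univ x)]
        refine (finsum_eq_sum_of_support_subset _ fun i hi ↦ ?_).symm
        simp only [hsdef, Set.Finite.coe_toFinset, Set.mem_ofPred_eq]
        exact ⟨x, hi, hx⟩
      rw [h1, one_mul]
    · simp [image_eq_zero_of_notMem_tsupport hx]
  have hsumf : (fun x ↦ ∑ i ∈ s, χ i x * ψ x) = ψ := funext hsum
  have hlip (i : M) (x : M) : LipschitzInChartAt n (fun x ↦ χ i x * ψ x) x :=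
    LipschitzInChartAt.comp₂ (F := fun p ↦ p.1 * p.2)
      (contMDiffAt_lipschitzInChartAt (((χ i).contMDiff x).of_le (by simp))) (hψ x)
      (ContDiffAt.exists_lipschitzOnWith (𝕂 := ℝ) (contDiff_fst.mul contDiff_snd).contDiffAt)
  have hci (i : M) : HasCompactSupport (fun x ↦ χ i x * ψ x) := hc.mul_left
  have hsi (i : M) : tsupport (fun x ↦ χ i x * ψ x) ⊆ V i ∩ U :=
    Set.subset_inter (tsupport_mul_subset_left.trans (hχ i)) (tsupport_mul_subset_right.trans hs)
  have hpiece (i : M) : ∫ x, w x * (χ i x * ψ x) ∂(riemannianVolume n M) ≤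
      -∫ x, inner ℝ (riemannianGrad n ρ x) (riemannianGrad n (fun x ↦ χ i x * ψ x) x)
        ∂(riemannianVolume n M) :=
    h.of_tsupport_subset_chart hw hρ ((hVo i).inter hU) Set.inter_subset_right
      (fun x hx ↦ (hVsub i hx.1).2) (fun x hx ↦ (hVsub i hx.1).1) (hlip i) (hci i) (hsi i)
      fun x ↦ mul_nonneg (χ.nonneg i x) (h0 x)
  have hψcont : Continuous ψ := continuous_iff_continuousAt.2 fun x ↦ (hψ x).continuousAt
  have hint (i : M) : Integrable (fun x ↦ w x * (χ i x * ψ x)) (riemannianVolume n M) :=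
    (hw.continuous_mul_of_tsupport_subset hU ((χ i).contMDiff.continuous.mul hψcont)
      ((hsi i).trans Set.inter_subset_right)).integrable_of_hasCompactSupport (hci i).mul_left
  -- The gradient is additive only where all summands are differentiable. Each piece lies in a
  -- chart, so Rademacher's theorem gives this almost everywhere.
  have hdiff : ∀ᵐ x ∂(riemannianVolume n M), ∀ i ∈ s,
      MDifferentiableAt (𝓡 n) 𝓘(ℝ, ℝ) (fun x ↦ χ i x * ψ x) x :=
    (ae_ball_iff s.countable_toSet).2 fun i _ ↦ ae_mdifferentiableAt_of_tsupport_subset (hlip i)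
      (hci i) ((hsi i).trans fun x hx ↦ (hVsub i hx.1).2)
  calc ∫ x, w x * ψ x ∂(riemannianVolume n M)
      = ∫ x, ∑ i ∈ s, w x * (χ i x * ψ x) ∂(riemannianVolume n M) := by
        simp_rw [← Finset.mul_sum, hsum]
    _ = ∑ i ∈ s, ∫ x, w x * (χ i x * ψ x) ∂(riemannianVolume n M) :=
        integral_finsetSum _ fun i _ ↦ hint i
    _ ≤ ∑ i ∈ s, -∫ x, inner ℝ (riemannianGrad n ρ x) (riemannianGrad n (fun x ↦ χ i x * ψ x) x)
        ∂(riemannianVolume n M) := Finset.sum_le_sum fun i _ ↦ hpiece i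
    _ = -∫ x, ∑ i ∈ s, inner ℝ (riemannianGrad n ρ x) (riemannianGrad n (fun x ↦ χ i x * ψ x) x)
        ∂(riemannianVolume n M) := by
        rw [Finset.sum_neg_distrib, integral_finsetSum _ fun i _ ↦
          integrable_inner_riemannianGrad hρ (hlip i) (hci i)
            ((hsi i).trans Set.inter_subset_right)]
    _ = _ := by
        congr 1
        refine integral_congr_ae ?_
        filter_upwards [hdiff] with x hx
        rw [← inner_sum, ← riemannianGrad_sum hx, hsumf]

end

/-! ### Young's inequality and the pointwise Hardy estimate. -/

/-- Young's inequality in the form `p a^(p-1) t ≤ (p-1) a^p + t^p`. -/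
theorem Real.mul_rpow_sub_one_mul_le {p a t : ℝ} (hp : 1 ≤ p) (ha : 0 ≤ a) (ht : 0 ≤ t) :
    p * a ^ (p - 1) * t ≤ (p - 1) * a ^ p + t ^ p := by
  have hp0 : 0 < p := one_pos.trans_le hp
  have h := Real.geom_mean_le_arith_mean2_weighted (w₁ := (p - 1) / p) (w₂ := 1 / p)
    (div_nonneg (by linarith) hp0.le) (by positivity) (Real.rpow_nonneg ha p)
    (Real.rpow_nonneg ht p) (by field_simp; ring)
  rw [← Real.rpow_mul ha, ← Real.rpow_mul ht, mul_div_cancel₀ _ hp0.ne', mul_div_cancel₀ _ hp0.ne',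
    Real.rpow_one] at h
  have h2 := mul_le_mul_of_nonneg_left h hp0.le
  field_simp at h2
  linarith

/-- The sign of the derivative is irrelevant, because the term that contains it is estimated by
Cauchy–Schwarz. -/
theorem Real.hasDerivAt_abs_rpow_of_ne_zero {b : ℝ} (hb : b ≠ 0) (p : ℝ) :
    ∃ d, HasDerivAt (fun t : ℝ ↦ |t| ^ p) d b ∧ |d| = |p| * |b| ^ (p - 1) := by
  refine ⟨_, (hasDerivAt_abs hb).rpow_const (Or.inl (abs_ne_zero.2 hb)), ?_⟩
  rw [abs_mul, abs_mul, abs_of_nonneg (Real.rpow_nonneg (abs_nonneg b) _)]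
  rcases hb.lt_or_gt with h | h <;> simp [h]

theorem IsContMDiffRiemannianBundle.isContinuousRiemannianBundle {n : ℕ} {M : Type*}
    [TopologicalSpace M] [ChartedSpace (EuclideanSpace ℝ (Fin n)) M] [IsManifold (𝓡 n) ∞ M]
    [RiemannianBundle (fun x : M ↦ TangentSpace (𝓡 n) x)]
    [h : IsContMDiffRiemannianBundle (𝓡 n) ∞ (EuclideanSpace ℝ (Fin n))
      (fun x : M ↦ TangentSpace (𝓡 n) x)] :
    IsContinuousRiemannianBundle (EuclideanSpace ℝ (Fin n))
      (fun x : M ↦ TangentSpace (𝓡 n) x) := by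
  obtain ⟨g, hg, hgi⟩ := h.exists_contMDiff
  exact ⟨g, hg.continuous, hgi⟩

section

open Topology Filter

variable {n : ℕ} {M : Type*} [TopologicalSpace M] [ChartedSpace (EuclideanSpace ℝ (Fin n)) M]
  [IsManifold (𝓡 n) ∞ M] {ρ φ : M → ℝ}

/-- On the support of φ, ρ ≠ 0, so the power with exponent γ is smooth near ρ x, while t ↦ t^p is C¹
because p ≥ 1. Off the support the product vanishes locally. -/
theorem lipschitzInChartAt_rpow_mul_abs_rpow
    (hρ : ∀ x, LipschitzInChartAt n ρ x) (hφ : IsTestFunction n {x | ρ x ≠ 0} φ) (γ : ℝ) {p : ℝ}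
    (hp : 1 ≤ p) (x : M) : LipschitzInChartAt n (fun z ↦ ρ z ^ γ * |φ z| ^ p) x := by
  have hp0 : p ≠ 0 := (one_pos.trans_le hp).ne'
  by_cases hx : x ∈ tsupport φ
  · have hρx : ρ x ≠ 0 := hφ.tsupport_subset hx
    have hφx : LipschitzInChartAt n φ x :=
      contMDiffAt_lipschitzInChartAt ((hφ.contMDiff x).of_le (by simp))
    have habs : LipschitzInChartAt n (fun z ↦ |φ z|) x :=
      hφx.comp₂ hφx (F := fun q ↦ |q.1|)
        ⟨_, _, univ_mem, (lipschitzWith_one_norm.comp LipschitzWith.prod_fst).lipschitzOnWith⟩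
    refine (hρ x).comp₂ habs (F := fun q ↦ q.1 ^ γ * q.2 ^ p)
      (ContDiffAt.exists_lipschitzOnWith (𝕂 := ℝ) ?_)
    exact (contDiffAt_fst.rpow_const_of_ne hρx).mul
      ((Real.contDiff_rpow_const_of_le (by simpa using hp)).comp contDiff_snd).contDiffAt
  · have hev : (fun _ ↦ (0 : ℝ)) =ᶠ[𝓝 x] fun z ↦ ρ z ^ γ * |φ z| ^ p := by
      filter_upwards [notMem_tsupport_iff_eventuallyEq.1 hx] with z hz
      simp [hz, Real.zero_rpow hp0]
    exact (contMDiffAt_lipschitzInChartAt contMDiffAt_const).congr hev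

variable [RiemannianBundle (fun x : M ↦ TangentSpace (𝓡 n) x)]

/-- The pointwise inequality behind the Hardy inequality. -/
theorem neg_inner_riemannianGrad_rpow_mul_abs_rpow_le {x : M} {γ α p l : ℝ} (hp : 1 ≤ p)
    (hγ : γ = α + 1 - p) (hl : 0 < l) (hρ0 : ∀ x, 0 ≤ ρ x)
    (hgrad : ρ x ≠ 0 → ‖riemannianGrad n ρ x‖ = 1) (hφ : IsTestFunction n {x | ρ x ≠ 0} φ) :
    l ^ (p - 1) * -inner ℝ (riemannianGrad n ρ x)
        (riemannianGrad n (fun z ↦ ρ z ^ γ * |φ z| ^ p) x) ≤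
      ((p - 1) * l ^ p - γ * l ^ (p - 1)) * (ρ x ^ α * (|φ x| ^ p / ρ x ^ p)) +
        ρ x ^ α * ‖riemannianGrad n φ x‖ ^ p := by
  have hp0 : p ≠ 0 := (one_pos.trans_le hp).ne'
  by_cases hφx : φ x = 0
  · have hmin : IsLocalMin (fun z ↦ ρ z ^ γ * |φ z| ^ p) x := by
      refine Eventually.of_forall fun z ↦ ?_
      simp only [hφx, abs_zero, Real.zero_rpow hp0, mul_zero]
      have := hρ0 z
      positivity
    rw [riemannianGrad_eq_zero_of_isLocalMin hmin, hφx]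
    have := hρ0 x
    simp [Real.zero_rpow hp0]
    positivity
  · have hρx : ρ x ≠ 0 := hφ.tsupport_subset (subset_tsupport _ hφx)
    have hr : 0 < ρ x := (hρ0 x).lt_of_ne' hρx
    have hg1 := hgrad hρx
    -- Differentiability of ρ comes from |∇ρ| = 1, since the gradient is zero by convention where it
    -- fails.
    have hρd : MDifferentiableAt (𝓡 n) 𝓘(ℝ, ℝ) ρ x := by
      by_contra h
      rw [riemannianGrad_eq_zero_of_not_mdifferentiableAt h, norm_zero] at hg1
      exact zero_ne_one hg1
    have hφd : MDifferentiableAt (𝓡 n) 𝓘(ℝ, ℝ) φ x :=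
      (hφ.contMDiff x).mdifferentiableAt (by simp)
    obtain ⟨d, hd, hdabs⟩ := Real.hasDerivAt_abs_rpow_of_ne_zero hφx p
    have h1 : HasDerivAt (fun t : ℝ ↦ t ^ γ) (γ * ρ x ^ (γ - 1)) (ρ x) :=
      Real.hasDerivAt_rpow_const (Or.inl hρx)
    have hF : HasFDerivAt (fun q : ℝ × ℝ ↦ q.1 ^ γ * |q.2| ^ p)
        ((γ * ρ x ^ (γ - 1) * |φ x| ^ p) • ContinuousLinearMap.fst ℝ ℝ ℝ +
          (ρ x ^ γ * d) • ContinuousLinearMap.snd ℝ ℝ ℝ) (ρ x, φ x) := by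
      have h2 := (h1.comp_hasFDerivAt (ρ x, φ x) (hasFDerivAt_fst (𝕜 := ℝ))).mul
        (hd.comp_hasFDerivAt (ρ x, φ x) (hasFDerivAt_snd (𝕜 := ℝ)))
      refine h2.congr_fderiv ?_
      ext <;> simp <;> ring
    have hgradψ := riemannianGrad_comp₂ hρd hφd hF
    rw [hgradψ, inner_add_right, inner_smul_right, inner_smul_right, real_inner_self_eq_norm_sq,
      hg1]
    set t := ‖riemannianGrad n φ x‖ with ht
    have ht0 : 0 ≤ t := norm_nonneg _
    set b := |φ x|
    have hb0 : 0 ≤ b := abs_nonneg _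
    have hinner : |inner ℝ (riemannianGrad n ρ x) (riemannianGrad n φ x)| ≤ t := by
      have := abs_real_inner_le_norm (riemannianGrad n ρ x) (riemannianGrad n φ x)
      rwa [hg1, one_mul] at this
    have h3 : -(ρ x ^ γ * d * inner ℝ (riemannianGrad n ρ x) (riemannianGrad n φ x)) ≤
        ρ x ^ γ * (p * b ^ (p - 1)) * t := by
      refine (neg_le_abs _).trans ?_
      rw [abs_mul, abs_mul, hdabs, abs_of_pos (Real.rpow_pos_of_pos hr γ),
        abs_of_pos (one_pos.trans_le hp)]
      exact mul_le_mul_of_nonneg_left hinner (by positivity)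
    have hA : ρ x ^ (γ - 1) * b ^ p = ρ x ^ α * (b ^ p / ρ x ^ p) := by
      rw [hγ, show α + 1 - p - 1 = α - p by ring, Real.rpow_sub hr]
      ring
    have hD : ρ x ^ γ * b ^ (p - 1) = ρ x ^ α * (b / ρ x) ^ (p - 1) := by
      rw [hγ, show α + 1 - p = α - (p - 1) by ring, Real.rpow_sub hr, Real.div_rpow hb0 hr.le]
      ring
    -- Young with a = l |φ| / ρ and t = |∇φ|; multiplying by ρ^α then yields the weighted
    -- integrands.
    have hY := Real.mul_rpow_sub_one_mul_le hp (mul_nonneg hl.le (div_nonneg hb0 hr.le)) ht0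
    rw [Real.mul_rpow hl.le (div_nonneg hb0 hr.le), Real.mul_rpow hl.le (div_nonneg hb0 hr.le),
      Real.div_rpow hb0 hr.le p] at hY
    have hY2 := mul_le_mul_of_nonneg_left hY (Real.rpow_nonneg hr.le α)
    have hlp : 0 ≤ l ^ (p - 1) := Real.rpow_nonneg hl.le _
    have h4 := mul_le_mul_of_nonneg_left h3 hlp
    have h5 : ρ x ^ γ * (p * b ^ (p - 1)) * t = p * (ρ x ^ α * (b / ρ x) ^ (p - 1)) * t := by
      rw [← hD]; ring
    rw [h5] at h4
    rw [← hA]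
    have h6 : ρ x ^ α * ((p - 1) * (l ^ p * (b ^ p / ρ x ^ p)) + t ^ p) =
        (p - 1) * l ^ p * (ρ x ^ (γ - 1) * b ^ p) + ρ x ^ α * t ^ p := by
      rw [hA]; ring
    rw [h6] at hY2
    nlinarith [h4, hY2]

end

/-! ### The weighted Hardy inequality. -/

theorem theorem2p2 {n : ℕ} (hn : 1 < n) {M : Type*} [EMetricSpace M]
    [ChartedSpace (EuclideanSpace ℝ (Fin n)) M] [IsManifold (𝓡 n) ∞ M]
    [RiemannianBundle (fun x : M ↦ TangentSpace (𝓡 n) x)]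
    [IsContMDiffRiemannianBundle (𝓡 n) ∞ (EuclideanSpace ℝ (Fin n))
      (fun x : M ↦ TangentSpace (𝓡 n) x)]
    [IsRiemannianManifold (𝓡 n) M] [SecondCountableTopology M]
    [MeasurableSpace M] [BorelSpace M] [CompleteSpace M] [NoncompactSpace M]
    (ρ : M → ℝ) (C : ℝ) (hC : 0 < C) (hρ_nonneg : ∀ x, 0 ≤ ρ x) (hρ_lip : LocallyLipschitz ρ)
    (hρ_grad : ∀ᵐ x ∂(riemannianVolume n M), ρ x ≠ 0 → ‖riemannianGrad n ρ x‖ = 1)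
    (hρ_lap : DistribLaplacianGE n {x : M | ρ x ≠ 0} ρ (fun x ↦ C / ρ x))
    (p α : ℝ) (hp : 1 ≤ p) (hα : 0 < C + 1 + α - p)
    (φ : M → ℝ) (hφ : IsTestFunction n {x : M | ρ x ≠ 0} φ) :
    ENNReal.ofReal (((C + 1 + α - p) / p) ^ p) *
        ∫⁻ x, ENNReal.ofReal (ρ x ^ α * (|φ x| ^ p / ρ x ^ p)) ∂(riemannianVolume n M) ≤
      ∫⁻ x, ENNReal.ofReal (ρ x ^ α * ‖riemannianGrad n φ x‖ ^ p) ∂(riemannianVolume n M) := by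
  have : IsContinuousRiemannianBundle (EuclideanSpace ℝ (Fin n))
      (fun x : M ↦ TangentSpace (𝓡 n) x) :=
    IsContMDiffRiemannianBundle.isContinuousRiemannianBundle
  have hp0 : 0 < p := one_pos.trans_le hp
  set U : Set M := {x | ρ x ≠ 0} with hUdef
  have hρc : Continuous ρ := hρ_lip.continuous
  have hU : IsOpen U := isOpen_ne_fun hρc continuous_const
  have hφc : Continuous φ := hφ.contMDiff.continuous
  have hrpow (β : ℝ) : ContinuousOn (fun x ↦ ρ x ^ β) U :=
    hρc.continuousOn.rpow_const fun x hx ↦ Or.inl hx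
  have hρ_chart (x : M) : LipschitzInChartAt n ρ x := hρ_lip.lipschitzInChartAt x
  have hφ_chart (x : M) : LipschitzInChartAt n φ x :=
    contMDiffAt_lipschitzInChartAt ((hφ.contMDiff x).of_le (by simp))
  have hφp : Continuous fun x ↦ |φ x| ^ p := hφc.abs.rpow_const fun x ↦ Or.inr hp0.le
  have hsupp : tsupport (fun x ↦ |φ x| ^ p) ⊆ tsupport φ := by
    refine closure_mono fun x hx hx0 ↦ hx ?_
    simp [hx0, Real.zero_rpow hp0.ne']
  have hsuppc : HasCompactSupport fun x ↦ |φ x| ^ p :=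
    hφ.hasCompactSupport.of_isClosed_subset (isClosed_tsupport _) hsupp
  set γ := α + 1 - p with hγ
  set l := (C + 1 + α - p) / p with hl
  have hl0 : 0 < l := div_pos hα hp0
  -- the weighted integrands
  have hAint : Integrable (fun x ↦ ρ x ^ α * (|φ x| ^ p / ρ x ^ p)) (riemannianVolume n M) := by
    have h1 : Continuous fun x ↦ (ρ x ^ α / ρ x ^ p) * |φ x| ^ p :=
      ((hrpow α).div (hrpow p) fun x hx ↦ (Real.rpow_pos_of_pos
        ((hρ_nonneg x).lt_of_ne' hx) p).ne').continuous_mul_of_tsupport_subset hU hφp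
        (hsupp.trans hφ.tsupport_subset)
    refine (h1.integrable_of_hasCompactSupport hsuppc.mul_left).congr (ae_of_all _ fun x ↦ ?_)
    ring
  have hBint : Integrable (fun x ↦ ρ x ^ α * ‖riemannianGrad n φ x‖ ^ p)
      (riemannianVolume n M) := by
    obtain ⟨D, hD⟩ := exists_norm_riemannianGrad_le hφ_chart hφ.hasCompactSupport.isCompact
    obtain ⟨R, hR⟩ := hφ.hasCompactSupport.isCompact.exists_bound_of_continuousOn
      ((hrpow α).mono hφ.tsupport_subset)
    have hint : IntegrableOn (fun _ ↦ R * D ^ p) (tsupport φ) (riemannianVolume n M) :=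
      integrableOn_const hφ.hasCompactSupport.isCompact.measure_lt_top.ne
    refine (hint.integrable_indicator (isClosed_tsupport φ).measurableSet).mono'
      ((hρc.measurable.pow_const α).aemeasurable.mul
        ((aemeasurable_norm_riemannianGrad φ _).pow_const p)).aestronglyMeasurable
      (ae_of_all _ fun x ↦ ?_)
    by_cases hx : x ∈ tsupport φ
    · rw [Set.indicator_of_mem hx, norm_mul, Real.norm_of_nonneg
        (Real.rpow_nonneg (norm_nonneg (riemannianGrad n φ x)) p)]
      exact mul_le_mul (hR x hx) (Real.rpow_le_rpow (norm_nonneg _) (hD x hx) hp0.le)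
        (Real.rpow_nonneg (norm_nonneg _) p) ((norm_nonneg _).trans (hR x hx))
    · rw [Set.indicator_of_notMem hx, riemannianGrad_eq_zero_of_notMem_tsupport hx, norm_zero,
        Real.zero_rpow hp0.ne', mul_zero, norm_zero]
  have hA0 (x : M) : 0 ≤ ρ x ^ α * (|φ x| ^ p / ρ x ^ p) := by
    have := hρ_nonneg x
    positivity
  have hB0 (x : M) : 0 ≤ ρ x ^ α * ‖riemannianGrad n φ x‖ ^ p :=
    mul_nonneg (Real.rpow_nonneg (hρ_nonneg x) α) (Real.rpow_nonneg (norm_nonneg _) p)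
  rw [← ofReal_integral_eq_lintegral_ofReal hAint (ae_of_all _ hA0),
    ← ofReal_integral_eq_lintegral_ofReal hBint (ae_of_all _ hB0),
    ← ENNReal.ofReal_mul (Real.rpow_nonneg hl0.le p)]
  refine ENNReal.ofReal_le_ofReal ?_
  set A := ∫ x, ρ x ^ α * (|φ x| ^ p / ρ x ^ p) ∂(riemannianVolume n M)
  set B := ∫ x, ρ x ^ α * ‖riemannianGrad n φ x‖ ^ p ∂(riemannianVolume n M)
  -- the test function
  have hψ_chart := lipschitzInChartAt_rpow_mul_abs_rpow hρ_chart hφ γ hp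
  have hψc : HasCompactSupport fun x ↦ ρ x ^ γ * |φ x| ^ p := hsuppc.mul_left
  have hψU : tsupport (fun x ↦ ρ x ^ γ * |φ x| ^ p) ⊆ U :=
    tsupport_mul_subset_right.trans (hsupp.trans hφ.tsupport_subset)
  have hgrad_le : ∀ᵐ x ∂(riemannianVolume n M), x ∈ U → ‖riemannianGrad n ρ x‖ ≤ 1 :=
    hρ_grad.mono fun x hx hxU ↦ (hx hxU).le
  have hw : ContinuousOn (fun x ↦ C / ρ x) U := continuousOn_const.div hρc.continuousOn fun x hx ↦ hx
  have hlap := hρ_lap.of_lipschitzInChartAt hU hw hgrad_le hψ_chart hψc hψU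
    fun x ↦ mul_nonneg (Real.rpow_nonneg (hρ_nonneg x) γ) (Real.rpow_nonneg (abs_nonneg _) p)
  have hCA : ∫ x, C / ρ x * (ρ x ^ γ * |φ x| ^ p) ∂(riemannianVolume n M) = C * A := by
    rw [← integral_const_mul]
    refine integral_congr_ae (ae_of_all _ fun x ↦ ?_)
    by_cases hx : φ x = 0
    · simp [hx, Real.zero_rpow hp0.ne']
    · have hr : 0 < ρ x :=
        (hρ_nonneg x).lt_of_ne' (hφ.tsupport_subset (subset_tsupport _ hx))
      have h1 : ρ x ^ γ = ρ x ^ α * ρ x / ρ x ^ p := by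
        rw [hγ, Real.rpow_sub hr, Real.rpow_add hr, Real.rpow_one]
      simp only [h1]
      field_simp
  rw [hCA] at hlap
  have hTint := integrable_inner_riemannianGrad hgrad_le hψ_chart hψc hψU
  have hmono : l ^ (p - 1) * -∫ x, inner ℝ (riemannianGrad n ρ x)
      (riemannianGrad n (fun z ↦ ρ z ^ γ * |φ z| ^ p) x) ∂(riemannianVolume n M) ≤
      ((p - 1) * l ^ p - γ * l ^ (p - 1)) * A + B := by
    rw [← integral_neg, ← integral_const_mul, ← integral_const_mul,
      ← integral_add (hAint.const_mul _) hBint]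
    refine integral_mono_ae (hTint.neg.const_mul _) ((hAint.const_mul _).add hBint) ?_
    filter_upwards [hρ_grad] with x hx
    exact neg_inner_riemannianGrad_rpow_mul_abs_rpow_le hp hγ hl0 hρ_nonneg hx hφ
  have h1 := (mul_le_mul_of_nonneg_left hlap (Real.rpow_nonneg hl0.le (p - 1))).trans hmono
  have h2 : l ^ p = l ^ (p - 1) * l := by
    rw [← Real.rpow_add_one hl0.ne', sub_add_cancel]
  -- This identity fixes the choice of l: it turns l^(p-1) (C + γ) A into p l^p A, leaving exactly
  -- l^p A after (p-1) l^p A is subtracted.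
  have h3 : p * l = C + γ := by
    rw [hl, mul_div_cancel₀ _ hp0.ne', hγ]; ring
  have h4 : p * l ^ p * A = l ^ (p - 1) * (C * A) + γ * l ^ (p - 1) * A := by
    rw [h2, show p * (l ^ (p - 1) * l) * A = (p * l) * (l ^ (p - 1) * A) by ring, h3]
    ring
  linarith
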